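/- Let $L$ be a linkoid diagram with $n$ components on $S^2$, i.e. a generic immersion of $n$ copies of $[0,1]$ in $S^2$ with over/under information at its (finitely many, transversal) double points, whose $2n$ endpoints are distinct from each other and from the double points and are labelled by $E=\{1,\dots,2n\}$. Let $\tau$ be its strand permutation (it interchanges the two labels of each component), and let $\sigma$ be a closure permutation, i.e. a fixed point free involution of $E$. Let $V$ be any diagram of the virtual closure $(L_\tau,\sigma)_v$, i.e. an oriented virtual link diagram obtained from $L$ by joining $i$ and $\sigma(i)$, for all $i\in E$, by closure arcs all of whose crossings are virtual; let $L$ carry the orientation induced by $V$. For both diagrams, a state $S$ is a choice of the oriented or the disoriented smoothing at each classical crossing; the labels of these smoothings are $A$ and $A^{-1}$ at a positive crossing, $A^{-1}$ and $A$ at a negative one, and $A^{\alpha(S)}$ is the product of the labels. A disoriented smoothing puts a cusp on each of its two branches, marking one side (that of the angle of the cusp). Two consecutive cusps of a closed component that mark the same side of it cancel. Put $d=-A^2-A^{-2}$ and let $K_1,K_2,\dots$ be variables. The generalized arrow polynomial of $L$ with respect to $\sigma$ is $$\langle L^\sigma\rangle_{\mathcal A}=\sum_S A^{\alpha(S)}\,d^{\,\mathrm{circ}(S)+|E/\langle\tau_S,\sigma\rangle|-1}\,\mathcal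 K_S\in\mathbb Z[A^{\pm1},K_1,K_2,\dots],$$ where $\mathrm{circ}(S)$ is the number of circular components of $S$, $\tau_S$ is the strand permutation of the open components of $S$, the elements of $E/\langle\tau_S,\sigma\rangle$ are the segment cycles (each regarded as a closed component, whose open segments are joined according to $\sigma$), and $\mathcal K_S$ is the product of the $K_i$ over all circular components and segment cycles on which $2i>0$ cusps survive the cancellation. The arrow polynomial of $V$ is $$\langle V\rangle_{\mathcal A}=\sum_S A^{\alpha(S)}\,d^{\,|S|-1}\,\mathcal K_S,$$ where $|S|$ is the number of loops of the state $S$ of $V$ (which may run through virtual crossings), and $\mathcal K_S$ is the product of the $K_i$ over the loops on which $2i>0$ cusps survive. (For $n=0$ both polynomials are taken to be $1$.) Then $$\langle L^\sigma\rangle_{\mathcal A}=\langle V\rangle_{\mathcal A},$$ and, with $\mathsf{Wr}$ denoting the writhe, also the normalized polynomials agree: $$(-A^3)^{-\mathsf{Wr}(L)}\langle L^\sigma\rangle_{\mathcal A}=(-A^3)^{-\mathsf{Wr}(V)}\langle V\rangle_{\mathcal A}.$$ -/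

import Mathlib

open Set
open scoped ContDiff

noncomputable section

/-! ### Generic curves on the 2-sphere

All curves live on the unit sphere of Euclidean 3-space, oriented by the outward normal.
A parameter is a pair (component, time). -/

/-- The determinant with rows `p`, `u`, `v`.  For `p` on the unit sphere and `u`, `v` tangent to
the sphere at `p` it is positive iff `(u, v)` is a positively oriented frame
(outward normal orientation). -/
def tripleDet (p u v : EuclideanSpace ℝ (Fin 3)) : ℝ :=
  Matrix.det !![p 0, p 1, p 2; u 0, u 1, u 2; v 0, v 1, v 2]

/-- Parameters in `dom` whose image point is also the image of another parameter in `dom`. -/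
def doubleParams {P : Type} (dom : Set P) (pt : P → EuclideanSpace ℝ (Fin 3)) : Set P :=
  {x | x ∈ dom ∧ ∃ y ∈ dom, y ≠ x ∧ pt y = pt x}

/-- The only singularities are finitely many transversal double points. -/
structure IsGenericCurve {P : Type} (dom : Set P) (pt vel : P → EuclideanSpace ℝ (Fin 3)) :
    Prop where
  finite : (doubleParams dom pt).Finite
  no_triple : ∀ x ∈ dom, ∀ y ∈ dom, ∀ z ∈ dom, pt x = pt y → pt y = pt z →
    x = y ∨ y = z ∨ x = z
  transverse : ∀ x ∈ dom, ∀ y ∈ dom, x ≠ y → pt x = pt y →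
    tripleDet (pt x) (vel x) (vel y) ≠ 0

/-- A linkoid diagram with `n` components on the 2-sphere, with labelled endpoints: a generic
immersion of `n` copies of `[0,1]`, whose `2 n` endpoints are distinct from each other and from
the double points, with over/under information at every double point.  `label (i, false)` is the
label of the foot (the image of `0`) of component `i`, `label (i, true)` that of its head. -/
structure LinkoidDiagram (n : ℕ) where
  curve : Fin n → ℝ → EuclideanSpace ℝ (Fin 3)
  on_sphere : ∀ i, ∀ t ∈ Icc (0 : ℝ) 1, ‖curve i t‖ = 1
  smooth : ∀ i, ContDiffOn ℝ ∞ (curve i) (Icc 0 1)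
  immersed : ∀ i, ∀ t ∈ Icc (0 : ℝ) 1, derivWithin (curve i) (Icc 0 1) t ≠ 0
  generic : IsGenericCurve {x : Fin n × ℝ | x.2 ∈ Icc (0 : ℝ) 1} (fun x => curve x.1 x.2)
    (fun x => derivWithin (curve x.1) (Icc 0 1) x.2)
  endpoints : ∀ x y : Fin n × ℝ, x.2 = 0 ∨ x.2 = 1 → y.2 ∈ Icc (0 : ℝ) 1 →
    curve y.1 y.2 = curve x.1 x.2 → y = x
  /-- At a double point with parameters `x`, `y`, the strand through `x` is the over-strand
  iff `x ∈ overSet`. -/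
  overSet : Set (Fin n × ℝ)
  over_iff : ∀ x y : Fin n × ℝ, x.2 ∈ Icc (0 : ℝ) 1 → y.2 ∈ Icc (0 : ℝ) 1 → x ≠ y →
    curve x.1 x.2 = curve y.1 y.2 → (x ∈ overSet ↔ y ∉ overSet)
  label : Fin n × Bool ≃ Fin (2 * n)

/-- An oriented virtual link diagram with `m` components on the 2-sphere: a generic immersion of
`m` oriented circles (smooth curves of period `1`, each point of a circle having a unique
parameter in `[0,1)`), each double point being either virtual or classical, with over/under
information at the classical ones. -/
structure VirtualLinkDiagram (m : ℕ) where
  curve : Fin m → ℝ → EuclideanSpace ℝ (Fin 3)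
  periodic : ∀ i, Function.Periodic (curve i) 1
  on_sphere : ∀ i t, ‖curve i t‖ = 1
  smooth : ∀ i, ContDiff ℝ ∞ (curve i)
  immersed : ∀ i t, deriv (curve i) t ≠ 0
  generic : IsGenericCurve {x : Fin m × ℝ | x.2 ∈ Ico (0 : ℝ) 1} (fun x => curve x.1 x.2)
    (fun x => deriv (curve x.1) x.2)
  /-- A double point with parameters `x`, `y` is virtual iff `x ∈ virt`. -/
  virt : Set (Fin m × ℝ)
  virt_iff : ∀ x y : Fin m × ℝ, x.2 ∈ Ico (0 : ℝ) 1 → y.2 ∈ Ico (0 : ℝ) 1 → x ≠ y →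
    curve x.1 x.2 = curve y.1 y.2 → (x ∈ virt ↔ y ∈ virt)
  overSet : Set (Fin m × ℝ)
  over_iff : ∀ x y : Fin m × ℝ, x.2 ∈ Ico (0 : ℝ) 1 → y.2 ∈ Ico (0 : ℝ) 1 → x ≠ y →
    curve x.1 x.2 = curve y.1 y.2 → x ∉ virt → (x ∈ overSet ↔ y ∉ overSet)

/-- The strand permutation: it interchanges the labels of the foot and the head of each
component. -/
def LinkoidDiagram.strandPerm {n : ℕ} (L : LinkoidDiagram n) : Equiv.Perm (Fin (2 * n)) :=
  (L.label.symm.trans ((Equiv.refl (Fin n)).prodCongr Equiv.boolNot)).trans L.label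

/-- Closure permutations: fixed point free involutions of the set of labels. -/
def IsClosurePerm {n : ℕ} (σ : Equiv.Perm (Fin (2 * n))) : Prop :=
  σ * σ = 1 ∧ ∀ e, σ e ≠ e

/-- An orientation of (each component of) a linkoid diagram: `o i = true` means that component `i`
is oriented from its foot to its head, `o i = false` that it is oriented from head to foot. -/
abbrev LinkoidOrientation (n : ℕ) : Type := Fin n → Bool

/-- `VirtualClosure L σ o V` exhibits the oriented virtual link diagram `V` as a diagram of the
virtual closure of `L` with respect to `σ`, such that the orientation of `V` restricts to the
orientation `o` of `L`.  The closure arcs are arbitrary, and all double points on them are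
virtual. -/
structure VirtualClosure {n m : ℕ} (L : LinkoidDiagram n) (σ : Equiv.Perm (Fin (2 * n)))
    (o : LinkoidOrientation n) (V : VirtualLinkDiagram m) where
  /-- the circle of `V` that contains component `i` of `L` -/
  comp : Fin n → Fin m
  /-- every circle of `V` contains a component of `L` -/
  comp_surjective : Function.Surjective comp
  /-- component `i` of `L` is the part of the circle `comp i` with parameters in
  `repar i '' [0,1]` -/
  repar : Fin n → ℝ → ℝ
  repar_smooth : ∀ i, ContDiffOn ℝ ∞ (repar i) (Icc 0 1)
  repar_orientation : ∀ i, ∀ t ∈ Icc (0 : ℝ) 1,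
    0 < (if o i then (1 : ℝ) else -1) * derivWithin (repar i) (Icc 0 1) t
  curve_eq : ∀ i, ∀ t ∈ Icc (0 : ℝ) 1, V.curve (comp i) (repar i t) = L.curve i t
  /-- the components of `L` occupy pairwise disjoint embedded intervals of the circles -/
  disjoint : ∀ i j, ∀ s ∈ Icc (0 : ℝ) 1, ∀ t ∈ Icc (0 : ℝ) 1, comp i = comp j →
    Int.fract (repar i s) = Int.fract (repar j t) → i = j ∧ s = t
  /-- the closure arcs: when a circle of `V` leaves component `i` of `L` at its terminal endpoint,
  the next point of `L` on that circle is the initial endpoint of a component `j`, and `σ` matches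
  these two endpoints -/
  closure_arc : ∀ i, ∃ j, ∃ u : ℝ,
    σ (L.label (i, o i)) = L.label (j, !(o j)) ∧ comp j = comp i ∧
    repar i (if o i then 1 else 0) < u ∧
    Int.fract u = Int.fract (repar j (if o j then 0 else 1)) ∧
    ∀ v ∈ Ioo (repar i (if o i then 1 else 0)) u, ∀ k, ∀ t ∈ Icc (0 : ℝ) 1,
      comp k = comp i → Int.fract v ≠ Int.fract (repar k t)
  /-- a double point of `V` is classical iff it is a double point of `L` -/
  classical_iff : ∀ x y : Fin m × ℝ, x.2 ∈ Ico (0 : ℝ) 1 → y.2 ∈ Ico (0 : ℝ) 1 → x ≠ y →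
    V.curve x.1 x.2 = V.curve y.1 y.2 →
    (x ∉ V.virt ↔
      (∃ i, ∃ t ∈ Icc (0 : ℝ) 1, x = (comp i, Int.fract (repar i t))) ∧
      (∃ j, ∃ s ∈ Icc (0 : ℝ) 1, y = (comp j, Int.fract (repar j s))))
  /-- over/under information at the crossings of `L` is kept -/
  over_iff : ∀ x ∈ doubleParams {x : Fin n × ℝ | x.2 ∈ Icc (0 : ℝ) 1}
      (fun x => L.curve x.1 x.2),
    ((comp x.1, Int.fract (repar x.1 x.2)) ∈ V.overSet ↔ x ∈ L.overSet)

/-! ### Combinatorics of the states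

Both kinds of diagrams are read through their crossings and the arcs joining them. Each classical
crossing has two passages (one on each strand).  A passage `x` has two darts, `(x, true)` leaving
the crossing and `(x, false)` arriving at it, in the sense of the orientation. A node is a dart or
a (labelled) endpoint; each arc of the diagram minus its crossings has two nodes as its ends. -/

/-- Crossings and arcs of an oriented diagram with set `E` of endpoint labels. -/
structure ArcData (E : Type) where
  Passage : Type
  /-- the other passage through the same crossing -/
  partner : Passage → Passage
  /-- the passages on over-strands -/
  overSet : Set Passage
  /-- `turn x` says whether the oriented strands through `x` and through `partner x`, in this
  order, form a positive frame.  If so, going into the crossing along the strand through `x`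
  (in either direction) and leaving it by a disoriented smoothing along the other strand is a
  right turn, and otherwise a left turn: the cusp marks the right, resp. the left, side. -/
  turn : Passage → Bool
  /-- the other end of the arc that ends at the given node -/
  mate : (Passage × Bool) ⊕ E → (Passage × Bool) ⊕ E

namespace ArcData

variable {E : Type} (G : ArcData E)

/-- Darts and endpoints. -/
abbrev Node : Type := (G.Passage × Bool) ⊕ E

/-- A state: the choice of a smoothing at each crossing, `true` for the oriented and `false` for
the disoriented one. -/
def State : Type := {s : G.Passage → Bool // ∀ x, s (G.partner x) = s x}

open Classical in
/-- The sign of the crossing that is met at an over-passage `x`. -/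
def sign (x : G.overSet) : ℤ := if G.turn x then 1 else -1

/-- The writhe. -/
def writhe : ℤ := ∑ᶠ x : G.overSet, G.sign x

/-- The sum of the smoothing labels: a positive crossing has label `1` for the oriented and `-1`
for the disoriented smoothing, a negative crossing the opposite ones. -/
def alpha (s : G.State) : ℤ :=
  ∑ᶠ x : G.overSet, G.sign x * (if s.1 x then 1 else -1)

variable {G}

/-- The smoothing at a crossing joins darts of the two strands: an arriving one with a leaving one
if it is oriented, and two arriving or two leaving ones if it is disoriented. -/
def jump (s : G.State) (d : G.Passage × Bool) : G.Passage × Bool :=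
  (G.partner d.1, if s.1 d.1 then !d.2 else d.2)

/-- Two nodes are adjacent in the state if an arc or a smoothing joins them. -/
def Adj (s : G.State) (a b : G.Node) : Prop :=
  b = G.mate a ∨ ∃ d, a = Sum.inl d ∧ b = Sum.inl (jump s d)

/-- The circular components of a state (that run through a crossing): the connected components
without endpoints. -/
def Circ (s : G.State) : Type :=
  {c : Quot (Adj s) // ∀ e : E, c ≠ Quot.mk _ (Sum.inr e)}

/-- The walk along an open segment of the state: from a node reached at the end of an arc to the
end of the next arc, stopping at endpoints. -/
def segmentStep (s : G.State) : G.Node → G.Node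
  | Sum.inl d => G.mate (Sum.inl (jump s d))
  | Sum.inr e => Sum.inr e

open Classical in
/-- The strand permutation of the state: it sends an endpoint to the other endpoint of its open
segment. -/
def tau (s : G.State) (e : E) : E :=
  if h : ∃ e' : E, ∃ k : ℕ, (segmentStep s)^[k] (G.mate (Sum.inr e)) = Sum.inr e'
  then h.choose else e

/-- The segment cycles of the state with respect to `σ`: the orbits of endpoint labels under the
strand permutation of the state and `σ`. -/
def SegmentCycle (s : G.State) (σ : E → E) : Type :=
  Quot (fun e e' : E => e' = tau s e ∨ e' = σ e)

/-- The walk along the closed components of the state, jumping from `e` to `σ e` at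
endpoints. -/
def walk (s : G.State) (σ : E → E) : G.Node → G.Node
  | Sum.inl d => G.mate (Sum.inl (jump s d))
  | Sum.inr e => G.mate (Sum.inr (σ e))

/-- The cusp passed when the walk leaves the given node: there is one exactly at disoriented
smoothings, recorded by the side that it marks (`true` for right). -/
def cusp (s : G.State) : G.Node → Option Bool
  | Sum.inl d => if s.1 d.1 then none else some (G.turn d.1)
  | Sum.inr _ => none

/-- The cyclic word of cusps that is read in going once around a component from a node on it. -/
def cuspWord (s : G.State) (σ : E → E) (a : G.Node) : List Bool :=
  (List.range (Function.minimalPeriod (walk s σ) a)).filterMap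
    (fun k => cusp s ((walk s σ)^[k] a))

end ArcData

/-- Cyclic words of cusps: two consecutive cusps that mark the same side cancel. -/
inductive CuspMove : List Bool → List Bool → Prop
  | rotate (w : List Bool) : CuspMove w (w.rotate 1)
  | cancel (b : Bool) (w : List Bool) : CuspMove (b :: b :: w) w

/-- The number of pairs of cusps that survive in a cyclic word of cusps. -/
def survivingPairs (w : List Bool) : ℕ :=
  sInf {k | ∃ w', Relation.EqvGen CuspMove w w' ∧ w'.length = k} / 2

/-- The ring of polynomials in `K₁, K₂, …` with coefficients in `ℤ[A, A⁻¹]`. -/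
abbrev ArrowRing : Type := MvPolynomial ℕ+ (LaurentPolynomial ℤ)

/-- The power `A ^ k`. -/
def powA (k : ℤ) : ArrowRing := MvPolynomial.C (LaurentPolynomial.T k)

/-- The loop value `d = -A² - A⁻²`. -/
def loopValue : ArrowRing := -powA 2 - powA (-2)

/-- The variable `K_i`, and `1` for `i = 0` (no surviving cusps). -/
def varK (i : ℕ) : ArrowRing := if h : 0 < i then MvPolynomial.X ⟨i, h⟩ else 1

/-- The factor `(-A ^ 3) ^ (-w)`, which normalizes a state sum of writhe `w`. -/
def writheFactor (w : ℤ) : ArrowRing := (((-1 : ℤˣ) ^ w : ℤˣ) : ℤ) • powA (-3 * w)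

/-! ### The generalized arrow polynomial of a linkoid -/

namespace LinkoidDiagram

variable {n : ℕ} (L : LinkoidDiagram n) (o : LinkoidOrientation n)

/-- The passages through the crossings. -/
def passages : Set (Fin n × ℝ) :=
  doubleParams {x : Fin n × ℝ | x.2 ∈ Icc (0 : ℝ) 1} (fun x => L.curve x.1 x.2)

theorem exists_partner (x : L.passages) :
    ∃ y : L.passages, y ≠ x ∧ L.curve y.1.1 y.1.2 = L.curve x.1.1 x.1.2 := by
  obtain ⟨x, hx, y, hy, hne, he⟩ := x
  exact ⟨⟨y, hy, x, hx, hne.symm, he.symm⟩, fun h => hne (congrArg Subtype.val h), he⟩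

/-- The other passage through the same crossing. -/
def partner (x : L.passages) : L.passages := (L.exists_partner x).choose

/-- The velocity with respect to the orientation `o`. -/
def velocity (x : Fin n × ℝ) : EuclideanSpace ℝ (Fin 3) :=
  (if o x.1 then (1 : ℝ) else -1) • derivWithin (L.curve x.1) (Icc 0 1) x.2

/-- The parameter of a node. -/
def nodeParam : (L.passages × Bool) ⊕ Fin (2 * n) → Fin n × ℝ
  | Sum.inl d => d.1.1
  | Sum.inr e => ((L.label.symm e).1, if (L.label.symm e).2 then 1 else 0)

/-- Whether parameters increase on the arc at a node, in going away from the node. -/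
def increasing : (L.passages × Bool) ⊕ Fin (2 * n) → Prop
  | Sum.inl d => d.2 = o d.1.1.1
  | Sum.inr e => (L.label.symm e).2 = false

/-- There is an arc, free of crossings, from the node `a` to the node `b`, on which parameters
increase. -/
def IsArc (a b : (L.passages × Bool) ⊕ Fin (2 * n)) : Prop :=
  L.increasing o a ∧ ¬ L.increasing o b ∧
  (L.nodeParam a).1 = (L.nodeParam b).1 ∧ (L.nodeParam a).2 < (L.nodeParam b).2 ∧
  ∀ t ∈ Ioo (L.nodeParam a).2 (L.nodeParam b).2, ((L.nodeParam a).1, t) ∉ L.passages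

open Classical in
/-- The crossings and arcs of a linkoid diagram with orientation `o`. -/
def arcData : ArcData (Fin (2 * n)) where
  Passage := L.passages
  partner := L.partner
  overSet := {x | x.1 ∈ L.overSet}
  turn := fun x => decide (0 < tripleDet (L.curve x.1.1 x.1.2) (L.velocity o x.1)
    (L.velocity o (L.partner x).1))
  mate := fun a => if h : ∃ b, L.IsArc o a b ∨ L.IsArc o b a then h.choose else a

/-- The product of the variables `K_i` of the components of a state: over its circular components
and over its segment cycles with respect to `σ`. -/
def stateK (σ : Equiv.Perm (Fin (2 * n))) (s : (L.arcData o).State) : ArrowRing :=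
  (∏ᶠ c : ArcData.Circ s, varK (survivingPairs (ArcData.cuspWord s σ c.1.out))) *
  ∏ᶠ c : ArcData.SegmentCycle s σ,
    varK (survivingPairs (ArcData.cuspWord s σ (Sum.inr (Quot.out c))))

/-- The generalized arrow polynomial of the linkoid diagram `L`, oriented by `o`, with respect
to `σ`. -/
def arrowPolynomial (σ : Equiv.Perm (Fin (2 * n))) : ArrowRing :=
  ∑ᶠ s : (L.arcData o).State,
    powA ((L.arcData o).alpha s) *
    loopValue ^ (Nat.card (ArcData.Circ s) + Nat.card (ArcData.SegmentCycle s σ) - 1) *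
    L.stateK o σ s

end LinkoidDiagram

/-! ### The arrow polynomial of a virtual link diagram -/

namespace VirtualLinkDiagram

variable {m : ℕ} (V : VirtualLinkDiagram m)

/-- The passages through the classical crossings. -/
def passages : Set (Fin m × ℝ) :=
  doubleParams {x : Fin m × ℝ | x.2 ∈ Ico (0 : ℝ) 1} (fun x => V.curve x.1 x.2) \ V.virt

theorem exists_partner (x : V.passages) :
    ∃ y : V.passages, y ≠ x ∧ V.curve y.1.1 y.1.2 = V.curve x.1.1 x.1.2 := by
  obtain ⟨x, ⟨hx, y, hy, hne, he⟩, hv⟩ := x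
  exact ⟨⟨y, ⟨hy, x, hx, hne.symm, he.symm⟩, fun h => hv ((V.virt_iff y x hy hx hne he).1 h)⟩,
    fun h => hne (congrArg Subtype.val h), he⟩

/-- The other passage through the same classical crossing. -/
def partner (x : V.passages) : V.passages := (V.exists_partner x).choose

/-- There is an arc, possibly through virtual crossings but free of classical ones, that starts
with the node `a` and follows the orientation of `V` until the node `b`. -/
def IsArc : (V.passages × Bool) ⊕ Empty → (V.passages × Bool) ⊕ Empty → Prop
  | Sum.inl a, Sum.inl b => a.2 = true ∧ b.2 = false ∧ a.1.1.1 = b.1.1.1 ∧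
      ∃ u : ℝ, a.1.1.2 < u ∧ Int.fract u = b.1.1.2 ∧
        ∀ v ∈ Ioo a.1.1.2 u, (a.1.1.1, Int.fract v) ∉ V.passages
  | _, _ => False

open Classical in
/-- The classical crossings and the arcs of a virtual link diagram, which has no endpoints. -/
def arcData : ArcData Empty where
  Passage := V.passages
  partner := V.partner
  overSet := {x | x.1 ∈ V.overSet}
  turn := fun x => decide (0 < tripleDet (V.curve x.1.1 x.1.2) (deriv (V.curve x.1.1) x.1.2)
    (deriv (V.curve (V.partner x).1.1) (V.partner x).1.2))
  mate := fun a => if h : ∃ b, V.IsArc a b ∨ V.IsArc b a then h.choose else a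

/-- The circles without classical crossings: they are loops without cusps of every state. -/
def freeCircles : ℕ := Nat.card {i : Fin m // ∀ t : ℝ, (i, t) ∉ V.passages}

/-- The arrow polynomial of a virtual link diagram (not normalized). -/
def arrowPolynomial : ArrowRing :=
  ∑ᶠ s : V.arcData.State,
    powA (V.arcData.alpha s) *
    loopValue ^ (Nat.card (ArcData.Circ s) + V.freeCircles - 1) *
    ∏ᶠ c : ArcData.Circ s, varK (survivingPairs (ArcData.cuspWord s id c.1.out))

end VirtualLinkDiagram

end

/-! Closure arcs carry only virtual crossings, so `L` and `V` have the same classical crossings,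
with the same signs and over/under data. Their states therefore correspond, with equal `alpha` and
writhe (`IsClosure.alpha_eq`, `IsClosure.writhe_eq`). It remains to compare loops and surviving
cusps state by state.

For a state `s` of `L`, let `ClosedComponent s σ` be the set of classes of nodes (darts and
endpoints) under two involutions: `mate` (follow an arc) and `through` (cross a smoothing, or jump
from `e` to `σ e`). This set is decomposed in two ways. By `bijective_toClosed` it is the disjoint
union of circular components and segment cycles, which is what the linkoid polynomial counts. By
`bijective_circToClosed` it is the disjoint union of the loops of the state of `V` that meet a
classical crossing and of the classes without darts; by `card_freeCircles` the latter match the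
circles of `V` without classical crossings. Hence the exponents of `d` agree.

For the cusps, `walk`, which is `mate` after `through`, goes around a closed component. Another
starting node or direction changes the cusp word by rotation, or by reversal with sides exchanged,
and `survivingPairs` is invariant under both; so every closed component has a well defined `weight`.
The walk of `V` is the first return of the walk of `L` to the darts, and endpoints carry no cusps,
so the two walks read identical words (`cuspWord_eq`). Classes without darts have weight `1`, and
both products of variables equal the product of all weights (`prod_eq`).

These combinatorial arguments rest on `IsClosure`. Its geometric content is `link_of_isArc`: an arc
of `V` between consecutive classical passages is a chain of arcs of `L` joined by closure arcs. The
chain is built by following the circle from component to component (`circle_induction`). -/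

/-! ### Cyclic words of cusps -/

/-- The word of cusps that is read in the opposite direction. -/
def reversedWord (w : List Bool) : List Bool := (w.map not).reverse

theorem survivingPairs_congr {w w' : List Bool} (h : Relation.EqvGen CuspMove w w') :
    survivingPairs w = survivingPairs w' := by
  have : {k | ∃ v, Relation.EqvGen CuspMove w v ∧ v.length = k} =
      {k | ∃ v, Relation.EqvGen CuspMove w' v ∧ v.length = k} := by
    ext k
    constructor
    · rintro ⟨v, hv, rfl⟩
      exact ⟨v, (h.symm).trans _ _ _ hv, rfl⟩
    · rintro ⟨v, hv, rfl⟩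
      exact ⟨v, h.trans _ _ _ hv, rfl⟩
  rw [survivingPairs, survivingPairs, this]

theorem survivingPairs_nil : survivingPairs [] = 0 := by
  have : sInf {k | ∃ v, Relation.EqvGen CuspMove [] v ∧ v.length = k} = 0 :=
    Nat.sInf_eq_zero.2 (Or.inl ⟨[], .refl _, rfl⟩)
  rw [survivingPairs, this]

theorem eqvGen_rotate_cons (x : Bool) (l : List Bool) :
    Relation.EqvGen CuspMove (x :: l) (l ++ [x]) := by
  have := CuspMove.rotate (x :: l)
  rw [List.rotate_cons_succ, List.rotate_zero] at this
  exact .rel _ _ this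

theorem CuspMove.reversedWord {w w' : List Bool} (h : CuspMove w w') :
    Relation.EqvGen CuspMove (reversedWord w) (reversedWord w') := by
  cases h with
  | rotate w =>
    cases w with
    | nil => exact .refl _
    | cons x l =>
      rw [List.rotate_cons_succ, List.rotate_zero]
      simpa [_root_.reversedWord] using (eqvGen_rotate_cons (!x) (_root_.reversedWord l)).symm
  | cancel b w =>
    -- Reversal puts the cancelling pair at the end of the word; two rotations bring it back to the
    -- front.
    have h1 := eqvGen_rotate_cons (!b) ((!b) :: _root_.reversedWord w')
    have h2 := eqvGen_rotate_cons (!b) (_root_.reversedWord w' ++ [!b])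
    have h3 : Relation.EqvGen CuspMove ((!b) :: (!b) :: _root_.reversedWord w')
      (_root_.reversedWord w') := .rel _ _ (.cancel _ _)
    have h4 := (h1.trans _ _ _ h2).symm.trans _ _ _ h3
    simpa [_root_.reversedWord] using h4

theorem reversedWord_reversedWord (w : List Bool) : reversedWord (reversedWord w) = w := by
  simp [reversedWord, List.map_reverse, Function.comp_def]

theorem eqvGen_reversedWord {w w' : List Bool} (h : Relation.EqvGen CuspMove w w') :
    Relation.EqvGen CuspMove (reversedWord w) (reversedWord w') := by
  induction h with
  | rel _ _ h => exact h.reversedWord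
  | refl _ => exact .refl _
  | symm _ _ _ ih => exact ih.symm
  | trans _ _ _ _ _ ih1 ih2 => exact ih1.trans _ _ _ ih2

/-- Reversing the direction of travel exchanges left and right and reverses the order of the cusps.
This respects the moves and preserves length, so the number of surviving pairs does not depend on
the direction. -/
theorem survivingPairs_reversedWord (w : List Bool) :
    survivingPairs (reversedWord w) = survivingPairs w := by
  have : {k | ∃ v, Relation.EqvGen CuspMove (reversedWord w) v ∧ v.length = k} =
      {k | ∃ v, Relation.EqvGen CuspMove w v ∧ v.length = k} := by
    ext k
    constructor
    · rintro ⟨v, hv, rfl⟩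
      refine ⟨reversedWord v, ?_, by simp [reversedWord]⟩
      simpa [reversedWord_reversedWord] using eqvGen_reversedWord hv
    · rintro ⟨v, hv, rfl⟩
      exact ⟨reversedWord v, eqvGen_reversedWord hv, by simp [reversedWord]⟩
  rw [survivingPairs, survivingPairs, this]

namespace ArcData

variable {E : Type} {G : ArcData E}

/-! ### Closed components of states -/

/-- The data of a diagram: the partner and mate maps are involutions, and a frame changes its
orientation when its vectors are interchanged. -/
structure IsRegular (G : ArcData E) : Prop where
  partner_partner : ∀ x, G.partner (G.partner x) = x
  turn_partner : ∀ x, G.turn (G.partner x) = !G.turn x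
  mate_mate : ∀ a, G.mate (G.mate a) = a

/-- The node from which a walk goes on that arrives at the given node. -/
def through (s : G.State) (σ : E → E) : G.Node → G.Node
  | Sum.inl d => Sum.inl (jump s d)
  | Sum.inr e => Sum.inr (σ e)

theorem walk_eq (s : G.State) (σ : E → E) (a : G.Node) :
    walk s σ a = G.mate (through s σ a) := by
  cases a <;> rfl

theorem through_through (hG : G.IsRegular) (s : G.State) {σ : E → E} (hσ : ∀ e, σ (σ e) = e)
    (a : G.Node) : through s σ (through s σ a) = a := by
  rcases a with ⟨x, b⟩ | e
  · simp only [through, jump, hG.partner_partner, s.2]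
    cases s.1 x <;> simp
  · simp [through, hσ]

/-- The same cusp met from its other branch is passed in the opposite direction, so it marks the
other side; this is `turn_partner`. -/
theorem cusp_through (hG : G.IsRegular) (s : G.State) (σ : E → E) (a : G.Node) :
    cusp s (through s σ a) = (cusp s a).map not := by
  rcases a with ⟨x, b⟩ | e
  · simp only [through, jump, cusp, s.2, hG.turn_partner]
    cases s.1 x <;> simp
  · rfl

/-- Two nodes are adjacent in the closed state if they are joined by an arc, by a smoothing or by
a closure arc. -/
def ClosedAdj (s : G.State) (σ : E → E) (a b : G.Node) : Prop :=
  b = G.mate a ∨ b = through s σ a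

section Walk

variable (hG : G.IsRegular) (s : G.State) {σ : E → E} (hσ : ∀ e, σ (σ e) = e)
include hG hσ

/-- Since `walk` is a product of two involutions, `through` conjugates it to its inverse: turning
round and walking undoes a step. -/
theorem walk_through_walk (a : G.Node) : walk s σ (through s σ (walk s σ a)) = through s σ a := by
  rw [walk_eq, through_through hG s hσ, walk_eq, hG.mate_mate]

theorem walk_injective : Function.Injective (walk s σ) := by
  intro a b h
  have := congrArg (fun c => walk s σ (through s σ c)) h
  simp only [walk_through_walk hG s hσ] at this
  simpa [through_through hG s hσ] using congrArg (through s σ) this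

theorem iterate_walk_through (k : ℕ) (a : G.Node) :
    (walk s σ)^[k] (through s σ ((walk s σ)^[k] a)) = through s σ a := by
  induction k generalizing a with
  | zero => rfl
  | succ k ih =>
    rw [Function.iterate_succ_apply, Function.iterate_succ_apply', walk_through_walk hG s hσ, ih]

theorem isPeriodicPt_through {k : ℕ} {a : G.Node} (h : Function.IsPeriodicPt (walk s σ) k a) :
    Function.IsPeriodicPt (walk s σ) k (through s σ a) := by
  have := iterate_walk_through hG s hσ k a
  rwa [h.eq] at this

theorem minimalPeriod_through (a : G.Node) :
    Function.minimalPeriod (walk s σ) (through s σ a) =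
      Function.minimalPeriod (walk s σ) a := by
  refine Function.minimalPeriod_eq_minimalPeriod_iff.2 fun k => ⟨fun h => ?_, fun h => ?_⟩
  · simpa [through_through hG s hσ] using isPeriodicPt_through hG s hσ h
  · exact isPeriodicPt_through hG s hσ h

variable [Finite G.Node]

theorem mem_periodicPts_walk (a : G.Node) : a ∈ Function.periodicPts (walk s σ) :=
  (walk_injective hG s hσ).mem_periodicPts a

theorem minimalPeriod_walk_pos (a : G.Node) : 0 < Function.minimalPeriod (walk s σ) a :=
  Function.minimalPeriod_pos_of_mem_periodicPts (mem_periodicPts_walk hG s hσ a)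

theorem eqvGen_cuspWord_walk (a : G.Node) :
    Relation.EqvGen CuspMove (cuspWord s σ a) (cuspWord s σ (walk s σ a)) := by
  have hp := minimalPeriod_walk_pos hG s hσ a
  have hper := Function.iterate_minimalPeriod (f := walk s σ) (x := a)
  obtain ⟨q, hq⟩ := Nat.exists_eq_succ_of_ne_zero hp.ne'
  rw [cuspWord, cuspWord, Function.minimalPeriod_apply (mem_periodicPts_walk hG s hσ a)]
  rw [hq] at hper ⊢
  rw [Nat.succ_eq_add_one] at *
  -- Moving the base point one step carries the letter at `a`, if there is one, from the front of
  -- the word to its end.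
  have h1 : (List.range (q + 1)).filterMap (fun k => cusp s ((walk s σ)^[k] a)) =
      [cusp s a].filterMap id ++
        (List.range q).filterMap (fun k => cusp s ((walk s σ)^[k + 1] a)) := by
    rw [List.range_succ_eq_map, ← List.singleton_append, List.filterMap_append,
      List.filterMap_map]
    congr 1
  have h2 : (List.range (q + 1)).filterMap (fun k => cusp s ((walk s σ)^[k] (walk s σ a))) =
      (List.range q).filterMap (fun k => cusp s ((walk s σ)^[k + 1] a)) ++
        [cusp s a].filterMap id := by
    rw [List.range_succ, List.filterMap_append]
    congr 1
    simp only [List.filterMap_cons, List.filterMap_nil, ← Function.iterate_succ_apply,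
      Nat.succ_eq_add_one, hper, id]
  rw [h1, h2]
  cases h : cusp s a with
  | none => simpa [h] using Relation.EqvGen.refl _
  | some b => simpa [h] using eqvGen_rotate_cons b _

theorem cuspWord_mate (a : G.Node) :
    cuspWord s σ (G.mate a) = reversedWord (cuspWord s σ a) := by
  have hp := minimalPeriod_walk_pos hG s hσ a
  have hm : Function.minimalPeriod (walk s σ) (G.mate a) =
      Function.minimalPeriod (walk s σ) a := by
    have : G.mate a = walk s σ (through s σ a) := by rw [walk_eq, through_through hG s hσ]
    rw [this, Function.minimalPeriod_apply (mem_periodicPts_walk hG s hσ _),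
      minimalPeriod_through hG s hσ]
  have hper := Function.iterate_minimalPeriod (f := walk s σ) (x := a)
  rw [cuspWord, cuspWord, hm]
  set p := Function.minimalPeriod (walk s σ) a
  -- The walk from the other end of the arc runs through the same nodes backwards. It starts at
  -- index `p - 1` because one more step from there closes the loop along the arc at `a`.
  have key : ∀ i < p, (walk s σ)^[i] (G.mate a) = through s σ ((walk s σ)^[p - 1 - i] a) := by
    intro i hi
    have h1 : G.mate a = through s σ ((walk s σ)^[p - 1] a) := by
      conv_lhs => rw [← hper, ← Nat.sub_add_cancel hp, Function.iterate_succ_apply', walk_eq,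
        hG.mate_mate]
    have h2 := iterate_walk_through hG s hσ i ((walk s σ)^[p - 1 - i] a)
    rwa [← Function.iterate_add_apply, show i + (p - 1 - i) = p - 1 by omega, ← h1] at h2
  rw [reversedWord, List.map_filterMap, ← List.filterMap_reverse, List.range_eq_range',
    List.reverse_range', List.filterMap_map, ← List.range_eq_range']
  refine List.filterMap_congr fun i hi => ?_
  rw [List.mem_range] at hi
  simp only [Function.comp_apply, key i hi, cusp_through hG s σ]
  congr 4
  omega

theorem survivingPairs_closedAdj {a b : G.Node} (h : ClosedAdj s σ a b) :
    survivingPairs (cuspWord s σ a) = survivingPairs (cuspWord s σ b) := by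
  rcases h with rfl | rfl
  · rw [cuspWord_mate hG s hσ, survivingPairs_reversedWord]
  · rw [survivingPairs_congr (eqvGen_cuspWord_walk hG s hσ a), walk_eq, cuspWord_mate hG s hσ,
      survivingPairs_reversedWord]

end Walk

end ArcData

/-! ### Closed components and their decomposition into circular components and segment cycles -/

namespace ArcData

variable {E : Type} {G : ArcData E}

/-- The closed components of a state, whose open segments are joined by closure arcs. -/
def ClosedComponent (s : G.State) (σ : E → E) : Type := Quot (ClosedAdj s σ)

section Closed

variable (hG : G.IsRegular) (s : G.State) {σ : E → E} (hσ : ∀ e, σ (σ e) = e)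

theorem mk_mate (s : G.State) (σ : E → E) (a : G.Node) :
    (Quot.mk _ (G.mate a) : ClosedComponent s σ) = Quot.mk _ a :=
  (Quot.sound (r := ClosedAdj s σ) (Or.inl rfl)).symm

theorem mk_through (s : G.State) (σ : E → E) (a : G.Node) :
    (Quot.mk _ (through s σ a) : ClosedComponent s σ) = Quot.mk _ a :=
  (Quot.sound (r := ClosedAdj s σ) (Or.inr rfl)).symm

theorem mk_walk (s : G.State) (σ : E → E) (a : G.Node) :
    (Quot.mk _ (walk s σ a) : ClosedComponent s σ) = Quot.mk _ a := by
  rw [walk_eq, mk_mate, mk_through]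

theorem mk_iterate_walk (s : G.State) (σ : E → E) (k : ℕ) (a : G.Node) :
    (Quot.mk _ ((walk s σ)^[k] a) : ClosedComponent s σ) = Quot.mk _ a := by
  induction k with
  | zero => rfl
  | succ k ih => rw [Function.iterate_succ_apply', mk_walk, ih]

include hG hσ

theorem ClosedAdj.symm {a b : G.Node} (h : ClosedAdj s σ a b) : ClosedAdj s σ b a := by
  rcases h with rfl | rfl
  · exact Or.inl (hG.mate_mate a).symm
  · exact Or.inr (through_through hG s hσ a).symm

/-- Both generating moves are involutions, so the generated equivalence relation needs no backward
steps. -/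
theorem eq_mk_iff_reflTransGen {a b : G.Node} :
    (Quot.mk _ a : ClosedComponent s σ) = Quot.mk _ b ↔
      Relation.ReflTransGen (ClosedAdj s σ) a b := by
  constructor
  · intro h
    have h' := Quot.eqvGen_exact h
    clear h
    induction h' with
    | rel _ _ h => exact .single h
    | refl _ => exact .refl
    | symm _ _ _ ih =>
      have : Std.Symm (ClosedAdj s σ) := ⟨fun _ _ h => ClosedAdj.symm hG s hσ h⟩
      exact Std.Symm.symm _ _ ih
    | trans _ _ _ _ _ ih1 ih2 => exact ih1.trans ih2
  · intro h
    induction h with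
    | refl => rfl
    | tail _ h ih => exact ih.trans (Quot.sound h)

variable [Finite G.Node]

theorem exists_iterate_walk_eq_of_walk (a b : G.Node) (h : walk s σ b = a) :
    ∃ k, (walk s σ)^[k] a = b := by
  obtain ⟨k, hk, hp⟩ := mem_periodicPts_walk hG s hσ b
  refine ⟨k - 1, ?_⟩
  rw [← h, ← Function.iterate_succ_apply, Nat.succ_eq_add_one, Nat.sub_add_cancel hk]
  exact hp

/-- A walk reaches all nodes of a closed component, up to the direction. -/
theorem exists_iterate_walk {a b : G.Node}
    (h : (Quot.mk _ a : ClosedComponent s σ) = Quot.mk _ b) :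
    ∃ k, (walk s σ)^[k] a = b ∨ (walk s σ)^[k] a = through s σ b := by
  rw [eq_mk_iff_reflTransGen hG s hσ] at h
  induction h with
  | refl => exact ⟨0, Or.inl rfl⟩
  | @tail b c _ h ih =>
    obtain ⟨k, ih⟩ := ih
    rcases h with rfl | rfl
    · rcases ih with ih | ih
      -- The node `through s σ (G.mate b)` is the predecessor of `b` under the walk; by periodicity
      -- a forward walk reaches it as well.
      · obtain ⟨j, hj⟩ := exists_iterate_walk_eq_of_walk hG s hσ b (through s σ (G.mate b))
          (by rw [walk_eq, through_through hG s hσ, hG.mate_mate])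
        exact ⟨j + k, Or.inr (by rw [Function.iterate_add_apply, ih, hj])⟩
      · refine ⟨k + 1, Or.inl ?_⟩
        rw [Function.iterate_succ_apply', ih, walk_eq, through_through hG s hσ]
    · refine ⟨k, ?_⟩
      rw [through_through hG s hσ]
      exact ih.symm

/-! ### Segment cycles -/

omit [Finite G.Node] hG hσ in
theorem iterate_segmentStep_endpoint (s : G.State) (k : ℕ) (e : E) :
    (segmentStep s)^[k] (Sum.inr e) = Sum.inr e := by
  induction k with
  | zero => rfl
  | succ k ih => rw [Function.iterate_succ_apply, segmentStep, ih]

omit [Finite G.Node] hG hσ in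
theorem segmentStep_exit_unique {s : G.State} {a : G.Node} {j k : ℕ} {e f : E}
    (h : (segmentStep s)^[j] a = Sum.inr e) (h' : (segmentStep s)^[k] a = Sum.inr f) :
    e = f := by
  wlog hjk : j ≤ k generalizing j k e f
  · exact (this h' h (by omega)).symm
  obtain ⟨i, rfl⟩ := Nat.exists_eq_add_of_le' hjk
  rw [Function.iterate_add_apply, h, iterate_segmentStep_endpoint] at h'
  exact Sum.inr_injective h'

omit [Finite G.Node] hG hσ in
theorem tau_eq {s : G.State} {e f : E} {k : ℕ}
    (h : (segmentStep s)^[k] (G.mate (Sum.inr e)) = Sum.inr f) : tau s e = f := by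
  have h' : ∃ e' : E, ∃ k : ℕ, (segmentStep s)^[k] (G.mate (Sum.inr e)) = Sum.inr e' :=
    ⟨f, k, h⟩
  rw [tau, dif_pos h']
  exact segmentStep_exit_unique h'.choose_spec.choose_spec h

omit [Finite G.Node] hG hσ in
theorem exists_segmentStep_of_walk {s : G.State} {a : G.Node} {k : ℕ} {e : E}
    (h : (walk s σ)^[k] a = Sum.inr e) : ∃ j f, (segmentStep s)^[j] a = Sum.inr f := by
  induction k generalizing a with
  | zero => exact ⟨0, e, h⟩
  | succ k ih =>
    rcases a with d | f
    · obtain ⟨j, f, hj⟩ := ih h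
      exact ⟨j + 1, f, hj⟩
    · exact ⟨0, f, rfl⟩

omit [Finite G.Node] hG hσ in
theorem SegmentCycle.mk_tau (s : G.State) (σ : E → E) (e : E) :
    (Quot.mk _ (tau s e) : SegmentCycle s σ) = Quot.mk _ e :=
  (Quot.sound (r := fun e e' : E => e' = tau s e ∨ e' = σ e) (Or.inl rfl)).symm

omit [Finite G.Node] hG hσ in
theorem SegmentCycle.mk_perm (s : G.State) (σ : E → E) (e : E) :
    (Quot.mk _ (σ e) : SegmentCycle s σ) = Quot.mk _ e :=
  (Quot.sound (r := fun e e' : E => e' = tau s e ∨ e' = σ e) (Or.inr rfl)).symm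

-- Walk and segment step agree at darts. At an endpoint `g` the walk jumps to `σ g` and then follows
-- the open segment to `tau s (σ g)`, so each further endpoint stays in the same orbit.
omit [Finite G.Node] hG hσ in
theorem segmentCycle_eq_of_walk {s : G.State} {a : G.Node} {j k : ℕ} {e f : E}
    (h : (walk s σ)^[k] a = Sum.inr e) (h' : (segmentStep s)^[j] a = Sum.inr f) :
    (Quot.mk _ f : SegmentCycle s σ) = Quot.mk _ e := by
  induction k generalizing a j f with
  | zero =>
    rw [Function.iterate_zero_apply] at h
    rw [h, iterate_segmentStep_endpoint] at h'
    rw [Sum.inr_injective h']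
  | succ k ih =>
    rcases a with d | g
    · cases j with
      | zero => cases h'
      | succ j => exact ih h h'
    · rw [iterate_segmentStep_endpoint] at h'
      obtain rfl := Sum.inr_injective h'
      obtain ⟨i, f', hi⟩ := exists_segmentStep_of_walk
        (show (walk s σ)^[k] (G.mate (Sum.inr (σ g))) = Sum.inr e from h)
      rw [← ih h hi, ← tau_eq hi, SegmentCycle.mk_tau, SegmentCycle.mk_perm]

omit [Finite G.Node] hG hσ in
theorem mk_segmentStep (s : G.State) (σ : E → E) (a : G.Node) :
    (Quot.mk _ (segmentStep s a) : ClosedComponent s σ) = Quot.mk _ a := by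
  rcases a with d | e
  · exact mk_walk s σ (Sum.inl d)
  · rfl

omit [Finite G.Node] hG hσ in
theorem mk_tau (s : G.State) (σ : E → E) (e : E) :
    (Quot.mk _ (Sum.inr (tau s e)) : ClosedComponent s σ) = Quot.mk _ (Sum.inr e) := by
  by_cases h : ∃ e' : E, ∃ k : ℕ, (segmentStep s)^[k] (G.mate (Sum.inr e)) = Sum.inr e'
  · obtain ⟨f, k, hk⟩ := h
    rw [tau_eq hk, ← hk]
    clear hk
    rw [← mk_mate s σ (Sum.inr e)]
    generalize G.mate (Sum.inr e) = a
    induction k with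
    | zero => rfl
    | succ k ih => rw [Function.iterate_succ_apply', mk_segmentStep, ih]
  -- Without an exit `tau s e` is by default `e`, and the claim is trivial.
  · rw [tau, dif_neg h]

omit [Finite G.Node] hG hσ in
/-- The closed component of a segment cycle. -/
def SegmentCycle.toClosed (s : G.State) (σ : E → E) : SegmentCycle s σ → ClosedComponent s σ :=
  Quot.lift (fun e => Quot.mk _ (Sum.inr e)) <| by
    rintro e e' (rfl | rfl)
    · exact (ArcData.mk_tau s σ e).symm
    · exact (mk_through s σ (Sum.inr e)).symm

theorem SegmentCycle.toClosed_injective : Function.Injective (SegmentCycle.toClosed s σ) := by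
  rintro ⟨e⟩ ⟨f⟩ h
  have key : ∀ e f : E, ∀ k, (walk s σ)^[k] (Sum.inr e) = Sum.inr f →
      (Quot.mk _ e : SegmentCycle s σ) = Quot.mk _ f :=
    fun e f k h => segmentCycle_eq_of_walk (j := 0) h rfl
  obtain ⟨k, hk | hk⟩ := exists_iterate_walk hG s hσ h
  · exact key e f k hk
  · exact (key e (σ f) k hk).trans (SegmentCycle.mk_perm s σ f)

/-! ### Circular components -/

omit [Finite G.Node] hG hσ in
theorem Adj.mk_closed_eq {s : G.State} {a b : G.Node} (h : Adj s a b) :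
    (Quot.mk _ a : ClosedComponent s σ) = Quot.mk _ b := by
  rcases h with rfl | ⟨d, rfl, rfl⟩
  · exact (mk_mate s σ a).symm
  · exact (mk_through s σ (Sum.inl d)).symm

omit [Finite G.Node] hG hσ in
/-- The closed component of a circular component. -/
def Circ.toClosed (s : G.State) (σ : E → E) (c : Circ s) : ClosedComponent s σ :=
  Quot.lift (fun a => Quot.mk _ a) (fun _ _ h => Adj.mk_closed_eq h) c.1

-- Closed adjacency adds to `Adj` only jumps between endpoints, and a component of the open state
-- without endpoints never meets one.
omit [Finite G.Node] in
theorem mk_adj_eq {a b : G.Node}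
    (h : (Quot.mk _ a : ClosedComponent s σ) = Quot.mk _ b)
    (ha : ∀ e : E, (Quot.mk _ a : Quot (Adj s)) ≠ Quot.mk _ (Sum.inr e)) :
    (Quot.mk _ a : Quot (Adj s)) = Quot.mk _ b := by
  rw [eq_mk_iff_reflTransGen hG s hσ] at h
  induction h with
  | refl => rfl
  | @tail b c _ h ih =>
    rcases h with rfl | rfl
    · exact ih.trans (Quot.sound (Or.inl rfl))
    · rcases b with d | e
      · exact ih.trans (Quot.sound (Or.inr ⟨d, rfl, rfl⟩))
      · exact absurd ih (ha e)

omit [Finite G.Node] in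
theorem Circ.toClosed_injective : Function.Injective (Circ.toClosed s σ) := by
  rintro ⟨⟨a⟩, ha⟩ ⟨⟨b⟩, hb⟩ h
  exact Subtype.ext (mk_adj_eq hG s hσ h ha)

omit [Finite G.Node] in
theorem Circ.toClosed_ne (c : Circ s) (e : E) : c.toClosed s σ ≠ Quot.mk _ (Sum.inr e) := by
  obtain ⟨⟨a⟩, ha⟩ := c
  exact fun h => ha e (mk_adj_eq hG s hσ h ha)

theorem bijective_toClosed :
    Function.Bijective (Sum.elim (Circ.toClosed s σ) (SegmentCycle.toClosed s σ)) := by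
  constructor
  · refine (Circ.toClosed_injective hG s hσ).sumElim (SegmentCycle.toClosed_injective hG s hσ) ?_
    rintro c ⟨e⟩
    exact Circ.toClosed_ne hG s hσ c e
  · rintro ⟨a⟩
    by_cases h : ∃ e : E, (Quot.mk _ a : Quot (Adj s)) = Quot.mk _ (Sum.inr e)
    · obtain ⟨e, he⟩ := h
      refine ⟨Sum.inr (Quot.mk _ e), ?_⟩
      exact (congrArg (Quot.lift (fun a => (Quot.mk _ a : ClosedComponent s σ))
        (fun _ _ h => Adj.mk_closed_eq h)) he).symm
    · push Not at h
      exact ⟨Sum.inl ⟨Quot.mk _ a, h⟩, rfl⟩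

end Closed

end ArcData

/-! ### Chains of arcs through closure arcs, and abstract closures -/

namespace ArcData

variable {E : Type} {G : ArcData E} {σ : E → E} {H : ArcData Empty} {φ : G.Passage ≃ H.Passage}

/-- Two nodes are linked if they are the ends of an arc that may run through closure arcs. -/
inductive Link (G : ArcData E) (σ : E → E) : G.Node → G.Node → Prop
  | mate (a : G.Node) : Link G σ a (G.mate a)
  | through (a : G.Node) (e : E) : Link G σ a (Sum.inr e) → Link G σ a (G.mate (Sum.inr (σ e)))

/-- Links grow at their far end; to reverse one, arcs have to be added at the near end. -/
theorem Link.prepend {a b : G.Node} {e : E} (h : Link G σ (Sum.inr (σ e)) b)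
    (ha : G.mate a = Sum.inr e) : Link G σ a b := by
  induction h with
  | mate =>
    have := Link.mate (σ := σ) a
    rw [ha] at this
    exact this.through
  | through f _ ih => exact ih.through

theorem Link.symm (hG : G.IsRegular) (hσ : ∀ e, σ (σ e) = e) {a b : G.Node} (h : Link G σ a b) :
    Link G σ b a := by
  induction h with
  | mate =>
    have := Link.mate (σ := σ) (G.mate a)
    rwa [hG.mate_mate] at this
  | through e _ ih =>
    refine Link.prepend (e := σ e) ?_ (hG.mate_mate _)
    rwa [hσ]

theorem Link.mk_eq (s : G.State) {a b : G.Node} (h : Link G σ a b) :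
    (Quot.mk _ a : ClosedComponent s σ) = Quot.mk _ b := by
  induction h with
  | mate => exact (mk_mate s σ a).symm
  | through e _ ih =>
    rw [ih, mk_mate]
    exact (mk_through s σ (Sum.inr e)).symm

/-- A link is a stretch of the walk with only endpoints in its interior, in whatever state. -/
theorem Link.exists_walk (s : G.State) {a b : G.Node} (h : Link G σ (ArcData.through s σ a) b) :
    ∃ r, (walk s σ)^[r + 1] a = b ∧
      ∀ i, 0 < i → i ≤ r → ∃ e, (walk s σ)^[i] a = Sum.inr e := by
  induction h with
  | mate => exact ⟨0, walk_eq s σ a, fun i h h' => by omega⟩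
  | through e _ ih =>
    obtain ⟨r, hr, hi⟩ := ih
    refine ⟨r + 1, by rw [Function.iterate_succ_apply', hr]; rfl, fun i h h' => ?_⟩
    rcases h'.lt_or_eq with h' | rfl
    · exact hi i h (by omega)
    · exact ⟨e, hr⟩

/-- `H` is obtained from `G` by joining its endpoints according to `σ`, where `φ` identifies the
passages through the crossings. -/
structure IsClosure (G : ArcData E) (σ : E → E) (H : ArcData Empty)
    (φ : G.Passage ≃ H.Passage) : Prop where
  regular : G.IsRegular
  involutive : ∀ e, σ (σ e) = e
  partner_eq : ∀ x, H.partner (φ x) = φ (G.partner x)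
  turn_eq : ∀ x, H.turn (φ x) = G.turn x
  over_iff : ∀ x, φ x ∈ H.overSet ↔ x ∈ G.overSet
  mate_eq : ∀ d : G.Passage × Bool, ∃ d' : G.Passage × Bool,
    H.mate (Sum.inl (φ d.1, d.2)) = Sum.inl (φ d'.1, d'.2) ∧
      Link G σ (Sum.inl d) (Sum.inl d')

/-- The nodes of a diagram without endpoints. -/
def dartEquiv (φ : G.Passage ≃ H.Passage) : G.Passage × Bool ≃ H.Node :=
  (φ.prodCongr (Equiv.refl Bool)).trans (Equiv.sumEmpty _ Empty).symm

theorem dartEquiv_apply (d : G.Passage × Bool) :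
    dartEquiv φ d = Sum.inl (φ d.1, d.2) := rfl

/-! ### States, walks and cusp words of a closure -/

namespace IsClosure

variable (h : IsClosure G σ H φ)
include h

theorem partner_symm (y : H.Passage) : G.partner (φ.symm y) = φ.symm (H.partner y) := by
  rw [Equiv.eq_symm_apply, ← h.partner_eq, Equiv.apply_symm_apply]

/-- The states of a diagram and of its closure. -/
def stateEquiv : G.State ≃ H.State where
  toFun s := ⟨fun y => s.1 (φ.symm y), fun y =>
    (congrArg s.1 (h.partner_symm y).symm).trans (s.2 _)⟩
  invFun s := ⟨fun x => s.1 (φ x), fun x =>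
    (congrArg s.1 (h.partner_eq x).symm).trans (s.2 _)⟩
  left_inv s := Subtype.ext (by ext x; simp)
  right_inv s := Subtype.ext (by ext x; simp)

theorem stateEquiv_apply (s : G.State) (x : G.Passage) : (h.stateEquiv s).1 (φ x) = s.1 x :=
  congrArg s.1 (φ.symm_apply_apply x)

/-- The passages on over-strands. -/
def overEquiv : G.overSet ≃ H.overSet :=
  φ.subtypeEquiv fun x => (h.over_iff x).symm

theorem sign_eq (x : G.overSet) : H.sign (h.overEquiv x) = G.sign x := by
  have : H.turn (h.overEquiv x).1 = G.turn x.1 := h.turn_eq x.1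
  simp [sign, this]

theorem writhe_eq : H.writhe = G.writhe := by
  rw [writhe, writhe, ← finsum_comp_equiv h.overEquiv]
  simp only [h.sign_eq]

theorem alpha_eq (s : G.State) : H.alpha (h.stateEquiv s) = G.alpha s := by
  rw [alpha, alpha, ← finsum_comp_equiv h.overEquiv]
  simp only [h.sign_eq]
  refine finsum_congr fun x => ?_
  rw [show ((h.overEquiv x).1) = φ x.1 from rfl, h.stateEquiv_apply]

theorem jump_eq (s : G.State) (d : G.Passage × Bool) :
    jump (h.stateEquiv s) (φ d.1, d.2) = (φ (jump s d).1, (jump s d).2) := by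
  simp only [jump, h.partner_eq, h.stateEquiv_apply]

/-- The first return of the walk to the darts. -/
def returnMap (s : G.State) (d : G.Passage × Bool) : G.Passage × Bool :=
  (dartEquiv φ).symm (walk (h.stateEquiv s) id (dartEquiv φ d))

theorem dartEquiv_returnMap (s : G.State) (d : G.Passage × Bool) :
    dartEquiv φ (h.returnMap s d) = walk (h.stateEquiv s) id (dartEquiv φ d) := by
  simp [returnMap]

theorem dartEquiv_iterate (s : G.State) (k : ℕ) (d : G.Passage × Bool) :
    dartEquiv φ ((h.returnMap s)^[k] d) =
      (walk (h.stateEquiv s) id)^[k] (dartEquiv φ d) := by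
  induction k with
  | zero => rfl
  | succ k ih => rw [Function.iterate_succ_apply', Function.iterate_succ_apply', ← ih,
      dartEquiv_returnMap]

theorem exists_return (s : G.State) (d : G.Passage × Bool) :
    ∃ r, (walk s σ)^[r + 1] (Sum.inl d) = Sum.inl (h.returnMap s d) ∧
      ∀ i, 0 < i → i ≤ r → ∃ e, (walk s σ)^[i] (Sum.inl d) = Sum.inr e := by
  obtain ⟨d', hd, hl⟩ := h.mate_eq (jump s d)
  have hR : h.returnMap s d = d' := by
    rw [returnMap, Equiv.symm_apply_eq, dartEquiv_apply, dartEquiv_apply, ← hd, ← h.jump_eq]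
    rfl
  rw [hR]
  exact Link.exists_walk s (a := Sum.inl d) hl

omit h in
/-- The darts that are met in the first steps of a walk. -/
def visits (s : G.State) (σ : E → E) (a : G.Node) (k : ℕ) : List (G.Passage × Bool) :=
  (List.range k).filterMap fun i => ((walk s σ)^[i] a).getLeft?

omit h in
theorem visits_add (s : G.State) (a : G.Node) (j k : ℕ) :
    visits s σ a (j + k) = visits s σ a j ++ visits s σ ((walk s σ)^[j] a) k := by
  rw [visits, List.range_add, List.filterMap_append, List.filterMap_map]
  congr 1
  refine List.filterMap_congr fun i _ => ?_
  rw [Function.comp_apply, add_comm, Function.iterate_add_apply]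

omit h in
theorem visits_return {s : G.State} {d : G.Passage × Bool} {r : ℕ}
    (hr : ∀ i, 0 < i → i ≤ r → ∃ e, (walk s σ)^[i] (Sum.inl d) = Sum.inr e) :
    visits s σ (Sum.inl d) (r + 1) = [d] := by
  induction r with
  | zero => rfl
  | succ r ih =>
    obtain ⟨e, he⟩ := hr (r + 1) (by omega) le_rfl
    rw [visits_add, ih fun i h h' => hr i h (by omega), he]
    rfl

/-- A walk between darts splits into first returns, each of which contributes one dart to the
visits. It cannot stop inside a return, since only endpoints lie there. -/
theorem visits_of_walk (s : G.State) {k : ℕ} {d d' : G.Passage × Bool}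
    (hk : (walk s σ)^[k] (Sum.inl d) = Sum.inl d') :
    ∃ j, (h.returnMap s)^[j] d = d' ∧
      visits s σ (Sum.inl d) k = (List.range j).map (fun i => (h.returnMap s)^[i] d) ∧
      (0 < k → 0 < j) := by
  induction k using Nat.strong_induction_on generalizing d with
  | _ k ih =>
    obtain rfl | hpos := Nat.eq_zero_or_pos k
    · exact ⟨0, Sum.inl_injective hk, rfl, fun h => h⟩
    obtain ⟨r, hr, hi⟩ := h.exists_return s d
    have hrk : r + 1 ≤ k := by
      by_contra hlt
      obtain ⟨e, he⟩ := hi k hpos (by omega)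
      rw [hk] at he
      cases he
    obtain ⟨k', rfl⟩ := Nat.exists_eq_add_of_le hrk
    have hk' : (walk s σ)^[k'] (Sum.inl (h.returnMap s d)) = Sum.inl d' := by
      rw [← hr, ← Function.iterate_add_apply, add_comm, hk]
    obtain ⟨j, hj, hv, -⟩ := ih k' (by omega) hk'
    refine ⟨j + 1, hj, ?_, fun _ => by omega⟩
    rw [visits_add, visits_return hi, hr, hv, List.range_succ_eq_map, List.map_cons, List.map_map]
    rfl

theorem exists_walk_iterate (s : G.State) (j : ℕ) (d : G.Passage × Bool) :
    ∃ k, (walk s σ)^[k] (Sum.inl d) = Sum.inl ((h.returnMap s)^[j] d) ∧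
      visits s σ (Sum.inl d) k = (List.range j).map (fun i => (h.returnMap s)^[i] d) := by
  induction j generalizing d with
  | zero => exact ⟨0, rfl, rfl⟩
  | succ j ih =>
    obtain ⟨r, hr, hi⟩ := h.exists_return s d
    obtain ⟨k, hk, hv⟩ := ih (h.returnMap s d)
    refine ⟨r + 1 + k, ?_, ?_⟩
    · rw [add_comm, Function.iterate_add_apply, hr, hk]
      rfl
    · rw [visits_add, visits_return hi, hr, hv, List.range_succ_eq_map, List.map_cons,
        List.map_map]
      rfl

omit h in
theorem cusp_eq_bind (s : G.State) (a : G.Node) :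
    cusp s a = a.getLeft?.bind (fun d => cusp s (Sum.inl d)) := by
  cases a <;> rfl

omit h in
theorem cuspWord_eq_filterMap_visits (s : G.State) (a : G.Node) :
    cuspWord s σ a = (visits s σ a (Function.minimalPeriod (walk s σ) a)).filterMap
      (fun d => cusp s (Sum.inl d)) := by
  rw [cuspWord, visits, List.filterMap_filterMap]
  exact List.filterMap_congr fun i _ => cusp_eq_bind s _

theorem minimalPeriod_returnMap (s : G.State) (d : G.Passage × Bool) :
    Function.minimalPeriod (walk (h.stateEquiv s) id) (dartEquiv φ d) =
      Function.minimalPeriod (h.returnMap s) d := by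
  refine Function.minimalPeriod_eq_minimalPeriod_iff.2 fun k => ?_
  rw [Function.IsPeriodicPt, Function.IsFixedPt, ← h.dartEquiv_iterate,
    (dartEquiv φ).apply_eq_iff_eq]
  rfl

variable [Finite G.Node]

/-- One period of the walk makes `j` returns, a positive multiple of the period of `returnMap`.
Conversely one period of `returnMap` is a closed walk, hence at least one walk period long, which
bounds `j` from above. -/
theorem visits_minimalPeriod (s : G.State) (d : G.Passage × Bool) :
    visits s σ (Sum.inl d) (Function.minimalPeriod (walk s σ) (Sum.inl d)) =
      (List.range (Function.minimalPeriod (h.returnMap s) d)).map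
        (fun i => (h.returnMap s)^[i] d) := by
  obtain ⟨j, hj, hv, hpos⟩ := h.visits_of_walk s (d := d)
    (Function.iterate_minimalPeriod (f := walk s σ) (x := Sum.inl d))
  have hjpos := hpos (minimalPeriod_walk_pos h.regular s h.involutive _)
  have hjp : Function.IsPeriodicPt (h.returnMap s) j d := hj
  have hle := hjp.minimalPeriod_le hjpos
  have hpos' := hjp.minimalPeriod_pos hjpos
  obtain ⟨k, hk, hv'⟩ := h.exists_walk_iterate s (Function.minimalPeriod (h.returnMap s) d) d
  rw [Function.iterate_minimalPeriod] at hk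
  have hkpos : 0 < k := by
    rcases Nat.eq_zero_or_pos k with rfl | h0
    · have := congrArg List.length hv'
      simp [visits] at this
      omega
    · exact h0
  have hle' := Function.IsPeriodicPt.minimalPeriod_le hkpos hk
  obtain ⟨i, rfl⟩ := Nat.exists_eq_add_of_le hle'
  have hlen := congrArg List.length hv'
  rw [visits_add, List.length_append, hv] at hlen
  simp only [List.length_map, List.length_range] at hlen
  rw [hv, show j = Function.minimalPeriod (h.returnMap s) d by omega]

theorem cuspWord_eq (s : G.State) (d : G.Passage × Bool) :
    cuspWord (h.stateEquiv s) id (dartEquiv φ d) = cuspWord s σ (Sum.inl d) := by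
  rw [cuspWord_eq_filterMap_visits s, h.visits_minimalPeriod, List.filterMap_map, cuspWord,
    h.minimalPeriod_returnMap]
  refine List.filterMap_congr fun i _ => ?_
  rw [← h.dartEquiv_iterate, dartEquiv_apply]
  simp only [cusp, h.stateEquiv_apply, h.turn_eq, Function.comp_apply]

/-! ### Components of the states of the closure -/

omit [Finite G.Node] in
theorem adj_mk_eq (s : G.State) {a b : H.Node} (hab : Adj (h.stateEquiv s) a b) :
    (Quot.mk _ (Sum.inl ((dartEquiv φ).symm a)) : ClosedComponent s σ) =
      Quot.mk _ (Sum.inl ((dartEquiv φ).symm b)) := by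
  obtain ⟨d, rfl⟩ := (dartEquiv φ).surjective a
  rw [Equiv.symm_apply_apply]
  rcases hab with rfl | ⟨c, hc, rfl⟩
  · obtain ⟨d', hd, hl⟩ := h.mate_eq d
    rw [dartEquiv_apply, hd, ← dartEquiv_apply, Equiv.symm_apply_apply]
    exact hl.mk_eq s
  · rw [dartEquiv_apply] at hc
    obtain rfl := Sum.inl_injective hc
    rw [h.jump_eq, ← dartEquiv_apply, Equiv.symm_apply_apply]
    exact (mk_through s σ (Sum.inl d)).symm

/-- The closed component of a component of a state of the closure. -/
def circToClosed (s : G.State) (c : Circ (h.stateEquiv s)) : ClosedComponent s σ :=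
  Quot.lift (fun a => Quot.mk _ (Sum.inl ((dartEquiv φ).symm a))) (fun _ _ => h.adj_mk_eq s) c.1

omit h [Finite G.Node] in
theorem mk_iterate_walk_adj {s : H.State} (a : H.Node) (k : ℕ) :
    (Quot.mk _ ((walk s id)^[k] a) : Quot (Adj s)) = Quot.mk _ a := by
  induction k with
  | zero => rfl
  | succ k ih =>
    rw [Function.iterate_succ_apply', ← ih]
    generalize (walk s id)^[k] a = b
    rcases b with d | e
    · exact ((Quot.sound (r := Adj s) (Or.inr ⟨d, rfl, rfl⟩)).trans
        (Quot.sound (r := Adj s) (Or.inl rfl))).symm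
    · exact e.elim

theorem circToClosed_injective (s : G.State) : Function.Injective (h.circToClosed s) := by
  rintro ⟨⟨a⟩, ha⟩ ⟨⟨b⟩, hb⟩ hab
  refine Subtype.ext ?_
  obtain ⟨d, rfl⟩ := (dartEquiv φ).surjective a
  obtain ⟨d', rfl⟩ := (dartEquiv φ).surjective b
  have key : ∀ d' k, (walk s σ)^[k] (Sum.inl d) = Sum.inl d' →
      (Quot.mk _ (dartEquiv φ d) : Quot (Adj (h.stateEquiv s))) =
        Quot.mk _ (dartEquiv φ d') := by
    intro d' k hk
    obtain ⟨j, rfl, -⟩ := h.visits_of_walk s hk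
    rw [h.dartEquiv_iterate]
    exact (mk_iterate_walk_adj _ j).symm
  have hab' : (Quot.mk _ (Sum.inl d) : ClosedComponent s σ) = Quot.mk _ (Sum.inl d') := by
    simp only [circToClosed, Equiv.symm_apply_apply] at hab
    exact hab
  obtain ⟨k, hk | hk⟩ := exists_iterate_walk h.regular s h.involutive hab'
  -- The walk reaches `d'` itself, or the dart joined to `d'` by the smoothing; the latter lies on
  -- the same loop of the closure.
  · exact key d' k hk
  · refine (key (jump s d') k hk).trans (Eq.symm (Quot.sound
      (Or.inr ⟨(φ d'.1, d'.2), rfl, ?_⟩)))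
    rw [h.jump_eq, dartEquiv_apply]

theorem bijective_circToClosed (s : G.State) :
    Function.Bijective (Sum.elim (h.circToClosed s)
      (Subtype.val : {c : ClosedComponent s σ // ∀ d, c ≠ Quot.mk _ (Sum.inl d)} → _)) := by
  constructor
  · refine (h.circToClosed_injective s).sumElim Subtype.val_injective ?_
    rintro ⟨⟨a⟩, ha⟩ ⟨c, hc⟩
    exact (hc _).symm
  · intro c
    by_cases hc : ∃ d, c = Quot.mk _ (Sum.inl d)
    · obtain ⟨d, rfl⟩ := hc
      refine ⟨Sum.inl ⟨Quot.mk _ (dartEquiv φ d), fun e => e.elim⟩, ?_⟩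
      exact congrArg (fun d => (Quot.mk _ (Sum.inl d) : ClosedComponent s σ))
        ((dartEquiv φ).symm_apply_apply d)
    · push Not at hc
      exact ⟨Sum.inr ⟨c, hc⟩, rfl⟩

/-- The contribution of a closed component. -/
noncomputable def weight (s : G.State) : ClosedComponent s σ → ArrowRing :=
  Quot.lift (fun a => varK (survivingPairs (cuspWord s σ a))) fun _ _ hab => by
    rw [survivingPairs_closedAdj h.regular s h.involutive hab]

theorem weight_eq_one (s : G.State) (c : ClosedComponent s σ)
    (hc : ∀ d, c ≠ Quot.mk _ (Sum.inl d)) : h.weight s c = 1 := by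
  obtain ⟨a⟩ := c
  have : cuspWord s σ a = [] := by
    rw [cuspWord, List.filterMap_eq_nil_iff]
    intro i _
    rcases hi : (walk s σ)^[i] a with d | e
    · exact absurd ((mk_iterate_walk s σ i a).symm.trans (by rw [hi])) (hc d)
    · rfl
  simp [weight, this, survivingPairs_nil, varK]

theorem weight_toClosed (s : G.State) (c : Circ s) :
    h.weight s (c.toClosed s σ) = varK (survivingPairs (cuspWord s σ c.1.out)) := by
  rw [Circ.toClosed, ← Quot.out_eq c.1]
  simp only [Quot.out_eq]
  rfl

theorem weight_segmentCycle (s : G.State) (c : SegmentCycle s σ) :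
    h.weight s (c.toClosed s σ) =
      varK (survivingPairs (cuspWord s σ (Sum.inr (Quot.out c)))) := by
  conv_lhs => rw [← Quot.out_eq c]
  rfl

theorem weight_circToClosed (s : G.State) (c : Circ (h.stateEquiv s)) :
    h.weight s (h.circToClosed s c) =
      varK (survivingPairs (cuspWord (h.stateEquiv s) id c.1.out)) := by
  rw [circToClosed, ← Quot.out_eq c.1]
  simp only [Quot.out_eq]
  conv_rhs => rw [← (dartEquiv φ).apply_symm_apply c.1.out, h.cuspWord_eq]
  rfl

omit h in
theorem finite_closedComponent (s : G.State) : Finite (ClosedComponent s σ) :=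
  Quot.finite _

theorem card_eq (s : G.State) :
    Nat.card (Circ s) + Nat.card (SegmentCycle s σ) = Nat.card (Circ (h.stateEquiv s)) +
      Nat.card {c : ClosedComponent s σ // ∀ d, c ≠ Quot.mk _ (Sum.inl d)} := by
  have b1 := bijective_toClosed h.regular s h.involutive
  have b2 := h.bijective_circToClosed s
  have := finite_closedComponent (σ := σ) s
  have f1 := Finite.of_injective _ b1.1
  have f2 := Finite.of_injective _ b2.1
  have : Finite (Circ s) := Finite.of_injective _ (Sum.inl_injective (β := SegmentCycle s σ))
  have : Finite (SegmentCycle s σ) := Finite.of_injective _ (Sum.inr_injective (α := Circ s))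
  have : Finite (Circ (h.stateEquiv s)) := Finite.of_injective _ (h.circToClosed_injective s)
  rw [← Nat.card_sum, ← Nat.card_sum, Nat.card_eq_of_bijective _ b1,
    Nat.card_eq_of_bijective _ b2]

omit h [Finite G.Node] in
theorem finprod_sum_type {α β : Type*} [Finite (α ⊕ β)] (f : α ⊕ β → ArrowRing) :
    ∏ᶠ x, f x = (∏ᶠ a, f (Sum.inl a)) * ∏ᶠ b, f (Sum.inr b) := by
  have : Finite α := Finite.of_injective _ (Sum.inl_injective (β := β))
  have : Finite β := Finite.of_injective _ (Sum.inr_injective (α := α))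
  have := Fintype.ofFinite α
  have := Fintype.ofFinite β
  rw [finprod_eq_prod_of_fintype, finprod_eq_prod_of_fintype, finprod_eq_prod_of_fintype,
    Fintype.prod_sum_type]

theorem prod_eq (s : G.State) :
    (∏ᶠ c : Circ s, varK (survivingPairs (cuspWord s σ c.1.out))) *
      ∏ᶠ c : SegmentCycle s σ, varK (survivingPairs (cuspWord s σ (Sum.inr (Quot.out c)))) =
    ∏ᶠ c : Circ (h.stateEquiv s),
      varK (survivingPairs (cuspWord (h.stateEquiv s) id c.1.out)) := by
  have b1 := bijective_toClosed h.regular s h.involutive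
  have b2 := h.bijective_circToClosed s
  have := finite_closedComponent (σ := σ) s
  have f1 := Finite.of_injective _ b1.1
  have f2 := Finite.of_injective _ b2.1
  have e1 := finprod_sum_type fun x => h.weight s
    (Sum.elim (Circ.toClosed s σ) (SegmentCycle.toClosed s σ) x)
  have e2 := finprod_sum_type fun x => h.weight s (Sum.elim (h.circToClosed s)
      (Subtype.val : {c : ClosedComponent s σ // ∀ d, c ≠ Quot.mk _ (Sum.inl d)} → _) x)
  rw [finprod_eq_of_bijective _ b1 fun _ => rfl] at e1
  rw [finprod_eq_of_bijective _ b2 fun _ => rfl, e1] at e2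
  simp only [Sum.elim_inl, Sum.elim_inr, h.weight_toClosed, h.weight_segmentCycle,
    h.weight_circToClosed] at e2
  have e3 : ∏ᶠ c : {c : ClosedComponent s σ // ∀ d, c ≠ Quot.mk _ (Sum.inl d)},
      h.weight s c.1 = 1 :=
    finprod_eq_one_of_forall_eq_one fun c => h.weight_eq_one s c.1 c.2
  rw [e2, e3, mul_one]

end IsClosure

end ArcData

/-! ### Crossings of linkoid diagrams -/

theorem tripleDet_swap (p u v : EuclideanSpace ℝ (Fin 3)) :
    tripleDet p v u = -tripleDet p u v := by
  simp only [tripleDet, Matrix.det_fin_three]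
  simp
  ring

theorem tripleDet_smul_smul (a b : ℝ) (p u v : EuclideanSpace ℝ (Fin 3)) :
    tripleDet p (a • u) (b • v) = a * b * tripleDet p u v := by
  simp only [tripleDet, Matrix.det_fin_three]
  simp
  ring

namespace LinkoidDiagram

variable {n : ℕ} (L : LinkoidDiagram n) (o : LinkoidOrientation n)

theorem finite_passages : Finite L.passages := L.generic.finite.to_subtype

theorem mem_Ioo_of_mem_passages {x : Fin n × ℝ} (hx : x ∈ L.passages) : x.2 ∈ Ioo (0 : ℝ) 1 := by
  obtain ⟨h, y, hy, hne, he⟩ := hx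
  have h0 : x.2 ≠ 0 := fun h0 => hne (L.endpoints x y (Or.inl h0) hy he)
  have h1 : x.2 ≠ 1 := fun h1 => hne (L.endpoints x y (Or.inr h1) hy he)
  exact ⟨lt_of_le_of_ne h.1 h0.symm, lt_of_le_of_ne h.2 h1⟩

theorem partner_ne (x : L.passages) : L.partner x ≠ x := (L.exists_partner x).choose_spec.1

theorem curve_partner (x : L.passages) :
    L.curve (L.partner x).1.1 (L.partner x).1.2 = L.curve x.1.1 x.1.2 :=
  (L.exists_partner x).choose_spec.2

/-- There are no triple points, so the chosen partner is the only possible one. -/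
theorem partner_unique {x y : L.passages} (hne : y ≠ x)
    (h : L.curve y.1.1 y.1.2 = L.curve x.1.1 x.1.2) : y = L.partner x := by
  rcases L.generic.no_triple y.1 y.2.1 x.1 x.2.1 (L.partner x).1 (L.partner x).2.1 h
    (L.curve_partner x).symm with h' | h' | h'
  · exact absurd (Subtype.ext h') hne
  · exact absurd (Subtype.ext h').symm (L.partner_ne x)
  · exact Subtype.ext h'

theorem partner_partner (x : L.passages) : L.partner (L.partner x) = x :=
  (L.partner_unique (L.partner_ne x).symm (L.curve_partner x).symm).symm

theorem tripleDet_velocity_ne_zero (x : L.passages) :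
    tripleDet (L.curve x.1.1 x.1.2) (L.velocity o x.1) (L.velocity o (L.partner x).1) ≠ 0 := by
  rw [velocity, velocity, tripleDet_smul_smul]
  refine mul_ne_zero (mul_ne_zero ?_ ?_) (L.generic.transverse x.1 x.2.1 (L.partner x).1
    (L.partner x).2.1 (fun h => L.partner_ne x (Subtype.ext h).symm) (L.curve_partner x).symm)
  all_goals split_ifs <;> norm_num

/-- The determinant is alternating, and by transversality nonzero, so exactly one of the two orders
gives a positive frame. -/
theorem turn_partner (x : L.passages) :
    (L.arcData o).turn (L.partner x) = !(L.arcData o).turn x := by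
  have h := L.tripleDet_velocity_ne_zero o x
  have h' := tripleDet_swap (L.curve x.1.1 x.1.2) (L.velocity o x.1)
    (L.velocity o (L.partner x).1)
  simp only [arcData]
  rw [L.partner_partner, L.curve_partner, h', Bool.eq_iff_iff]
  rcases lt_or_gt_of_ne h with h | h
  · simp [h, h.le]
  · simp [h, h.le]

/-! ### Arcs of linkoid diagrams -/

theorem nodeParam_mem_Icc (a : (L.passages × Bool) ⊕ Fin (2 * n)) :
    (L.nodeParam a).2 ∈ Icc (0 : ℝ) 1 := by
  rcases a with d | e
  · exact Ioo_subset_Icc_self (L.mem_Ioo_of_mem_passages d.1.2)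
  · simp only [nodeParam]
    split_ifs <;> simp

theorem nodeParam_lt_one {a : (L.passages × Bool) ⊕ Fin (2 * n)} (h : L.increasing o a) :
    (L.nodeParam a).2 < 1 := by
  rcases a with d | e
  · exact (L.mem_Ioo_of_mem_passages d.1.2).2
  · simp only [increasing] at h
    simp [nodeParam, h]

theorem nodeParam_pos {a : (L.passages × Bool) ⊕ Fin (2 * n)} (h : ¬ L.increasing o a) :
    0 < (L.nodeParam a).2 := by
  rcases a with d | e
  · exact (L.mem_Ioo_of_mem_passages d.1.2).1
  · simp only [increasing, Bool.not_eq_false] at h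
    simp [nodeParam, h]

theorem nodeParam_mem_passages {a : (L.passages × Bool) ⊕ Fin (2 * n)}
    (h0 : (L.nodeParam a).2 ≠ 0) (h1 : (L.nodeParam a).2 ≠ 1) : L.nodeParam a ∈ L.passages := by
  rcases a with d | e
  · exact d.1.2
  · simp only [nodeParam] at h0 h1
    split_ifs at h0 h1 <;> simp at h0 h1

/-- Only the two darts of one passage share a parameter, and they point in opposite directions. -/
theorem node_ext {a b : (L.passages × Bool) ⊕ Fin (2 * n)} (hp : L.nodeParam a = L.nodeParam b)
    (hi : L.increasing o a ↔ L.increasing o b) : a = b := by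
  have key : ∀ (d : L.passages × Bool) (e : Fin (2 * n)),
      L.nodeParam (Sum.inl d) ≠ L.nodeParam (Sum.inr e) := by
    intro d e h
    have := L.mem_Ioo_of_mem_passages d.1.2
    have h2 := congrArg Prod.snd h
    simp only [nodeParam] at h2
    rw [h2] at this
    split_ifs at this <;> simp at this
  rcases a with ⟨x, p⟩ | e <;> rcases b with ⟨y, q⟩ | f
  · obtain rfl : x = y := Subtype.ext hp
    simp only [increasing] at hi
    congr 2
    revert hi
    cases p <;> cases q <;> cases o x.1.1 <;> simp
  · exact absurd hp (key _ _)
  · exact absurd hp.symm (key _ _)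
  · simp only [increasing, nodeParam] at hi hp
    have h1 := congrArg Prod.fst hp
    have h2 : (L.label.symm e).2 = (L.label.symm f).2 := by
      revert hi
      cases (L.label.symm e).2 <;> cases (L.label.symm f).2 <;> simp
    rw [L.label.symm.injective (Prod.ext h1 h2)]

variable {L o}

theorem IsArc.unique_right {a b c : (L.passages × Bool) ⊕ Fin (2 * n)} (h : L.IsArc o a b)
    (h' : L.IsArc o a c) : b = c := by
  wlog hbc : (L.nodeParam b).2 ≤ (L.nodeParam c).2 generalizing b c
  · exact (this h' h (le_of_not_ge hbc)).symm
  obtain ⟨ha, hb, he, hlt, hno⟩ := h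
  obtain ⟨-, hc, he', hlt', hno'⟩ := h'
  rcases hbc.lt_or_eq with hbc | hbc
  · have hp := L.nodeParam_mem_passages (a := b) (L.nodeParam_pos o hb).ne'
      (hbc.trans_le (L.nodeParam_mem_Icc c).2).ne
    -- The nearer end would be a passage inside the longer arc.
    exact absurd (by rwa [he]) (hno' _ ⟨hlt, hbc⟩)
  · exact L.node_ext o (Prod.ext (he.symm.trans he') hbc) (by tauto)

theorem IsArc.unique_left {a b c : (L.passages × Bool) ⊕ Fin (2 * n)} (h : L.IsArc o a c)
    (h' : L.IsArc o b c) : a = b := by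
  wlog hab : (L.nodeParam a).2 ≤ (L.nodeParam b).2 generalizing a b
  · exact (this h' h (le_of_not_ge hab)).symm
  obtain ⟨ha, hc, he, hlt, hno⟩ := h
  obtain ⟨hb, -, he', hlt', hno'⟩ := h'
  rcases hab.lt_or_eq with hab | hab
  · have hp := L.nodeParam_mem_passages (a := b)
      ((L.nodeParam_mem_Icc a).1.trans_lt hab).ne' (L.nodeParam_lt_one o hb).ne
    exact absurd (by rwa [he, ← he']) (hno _ ⟨hab, hlt'⟩)
  · exact L.node_ext o (Prod.ext (he.trans he'.symm) hab) (by tauto)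

theorem exists_isArc_right {a : (L.passages × Bool) ⊕ Fin (2 * n)} (ha : L.increasing o a) :
    ∃ b, L.IsArc o a b := by
  set i := (L.nodeParam a).1 with hi
  set t := (L.nodeParam a).2 with ht
  have hfin : {x | x ∈ L.passages ∧ x.1 = i ∧ t < x.2}.Finite :=
    L.generic.finite.subset fun x hx => hx.1
  -- The arc ends at the head of the component if no passage follows, and otherwise at the next
  -- passage.
  rcases Set.eq_empty_or_nonempty {x | x ∈ L.passages ∧ x.1 = i ∧ t < x.2} with h | h
  · refine ⟨Sum.inr (L.label (i, true)), ha, by simp [increasing], by simp [nodeParam, hi],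
      by simpa [nodeParam] using L.nodeParam_lt_one o ha, fun u hu hp => ?_⟩
    exact Set.eq_empty_iff_forall_notMem.1 h (i, u) ⟨hp, rfl, hu.1⟩
  · obtain ⟨x, ⟨hx, hxi, hxt⟩, hmin⟩ := Set.exists_min_image _ Prod.snd hfin h
    refine ⟨Sum.inl (⟨x, hx⟩, !o x.1), ha, by simp [increasing], hxi.symm, hxt,
      fun u hu hp => ?_⟩
    exact absurd (hmin (i, u) ⟨hp, rfl, hu.1⟩) (not_le.2 hu.2)

theorem exists_isArc_left {b : (L.passages × Bool) ⊕ Fin (2 * n)} (hb : ¬ L.increasing o b) :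
    ∃ a, L.IsArc o a b := by
  set i := (L.nodeParam b).1 with hi
  set t := (L.nodeParam b).2 with ht
  have hfin : {x | x ∈ L.passages ∧ x.1 = i ∧ x.2 < t}.Finite :=
    L.generic.finite.subset fun x hx => hx.1
  rcases Set.eq_empty_or_nonempty {x | x ∈ L.passages ∧ x.1 = i ∧ x.2 < t} with h | h
  · refine ⟨Sum.inr (L.label (i, false)), by simp [increasing], hb, by simp [nodeParam, hi],
      by simpa [nodeParam] using L.nodeParam_pos o hb, fun u hu hp => ?_⟩
    simp only [nodeParam, Equiv.symm_apply_apply] at hp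
    exact Set.eq_empty_iff_forall_notMem.1 h (i, u) ⟨hp, rfl, hu.2⟩
  · obtain ⟨x, ⟨hx, hxi, hxt⟩, hmax⟩ := Set.exists_max_image _ Prod.snd hfin h
    refine ⟨Sum.inl (⟨x, hx⟩, o x.1), by simp [increasing], hb, hxi, hxt,
      fun u hu hp => ?_⟩
    exact absurd (hmax (x.1, u) ⟨hp, hxi, hu.2⟩) (not_le.2 hu.1)

theorem mate_spec (a : (L.passages × Bool) ⊕ Fin (2 * n)) :
    L.IsArc o a ((L.arcData o).mate a) ∨ L.IsArc o ((L.arcData o).mate a) a := by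
  have h : ∃ b, L.IsArc o a b ∨ L.IsArc o b a := by
    by_cases ha : L.increasing o a
    · exact (exists_isArc_right ha).imp fun _ => Or.inl
    · exact (exists_isArc_left ha).imp fun _ => Or.inr
  have : (L.arcData o).mate a = h.choose := dif_pos h
  rw [this]
  exact h.choose_spec

theorem mate_eq {a b : (L.passages × Bool) ⊕ Fin (2 * n)} (h : L.IsArc o a b ∨ L.IsArc o b a) :
    (L.arcData o).mate a = b := by
  rcases h with h | h <;> rcases mate_spec (o := o) a with h' | h'
  · exact h'.unique_right h
  · exact absurd h.1 h'.2.1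
  · exact absurd h'.1 h.2.1
  · exact h'.unique_left h

theorem arcData_isRegular : (L.arcData o).IsRegular where
  partner_partner := L.partner_partner
  turn_partner := L.turn_partner o
  mate_mate a := mate_eq (mate_spec a).symm

end LinkoidDiagram

/-! ### Periodic curves and crossings of virtual link diagrams -/

theorem Function.Periodic.map_fract {α : Type*} {f : ℝ → α} (h : Function.Periodic f 1) (t : ℝ) :
    f (Int.fract t) = f t := by
  have := h.sub_int_mul_eq (x := t) ⌊t⌋
  rwa [mul_one] at this

theorem Function.Periodic.deriv_periodic {F : Type*} [NormedAddCommGroup F] [NormedSpace ℝ F]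
    {f : ℝ → F} {c : ℝ} (h : Function.Periodic f c) : Function.Periodic (deriv f) c := by
  intro t
  rw [← deriv_comp_add_const]
  congr 1
  exact funext h

namespace VirtualLinkDiagram

variable {m : ℕ} (V : VirtualLinkDiagram m)

theorem partner_ne (x : V.passages) : V.partner x ≠ x := (V.exists_partner x).choose_spec.1

theorem curve_partner (x : V.passages) :
    V.curve (V.partner x).1.1 (V.partner x).1.2 = V.curve x.1.1 x.1.2 :=
  (V.exists_partner x).choose_spec.2

theorem partner_unique {x y : V.passages} (hne : y ≠ x)
    (h : V.curve y.1.1 y.1.2 = V.curve x.1.1 x.1.2) : y = V.partner x := by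
  rcases V.generic.no_triple y.1 y.2.1.1 x.1 x.2.1.1 (V.partner x).1 (V.partner x).2.1.1 h
    (V.curve_partner x).symm with h' | h' | h'
  · exact absurd (Subtype.ext h') hne
  · exact absurd (Subtype.ext h').symm (V.partner_ne x)
  · exact Subtype.ext h'

theorem finite_passages : Finite V.passages :=
  (V.generic.finite.subset fun _ hx => hx.1).to_subtype

end VirtualLinkDiagram

/-! ### Identification of the classical crossings of the closure with those of the linkoid -/

namespace VirtualClosure

variable {n m : ℕ} {L : LinkoidDiagram n} {σ : Equiv.Perm (Fin (2 * n))}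
  {o : LinkoidOrientation n} {V : VirtualLinkDiagram m} (hV : VirtualClosure L σ o V)

theorem continuousOn_repar (i : Fin n) : ContinuousOn (hV.repar i) (Icc 0 1) :=
  (hV.repar_smooth i).continuousOn

theorem deriv_repar_pos (i : Fin n) {t : ℝ} (ht : t ∈ Ioo (0 : ℝ) 1) :
    0 < (if o i then (1 : ℝ) else -1) * deriv (hV.repar i) t := by
  rw [← derivWithin_of_mem_nhds (Icc_mem_nhds ht.1 ht.2)]
  exact hV.repar_orientation i t (Ioo_subset_Icc_self ht)

theorem strictMonoOn_repar {i : Fin n} (h : o i = true) :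
    StrictMonoOn (hV.repar i) (Icc 0 1) := by
  refine strictMonoOn_of_deriv_pos (convex_Icc 0 1) (hV.continuousOn_repar i) fun t ht => ?_
  rw [interior_Icc] at ht
  simpa [h] using hV.deriv_repar_pos i ht

theorem strictAntiOn_repar {i : Fin n} (h : o i = false) :
    StrictAntiOn (hV.repar i) (Icc 0 1) := by
  refine strictAntiOn_of_deriv_neg (convex_Icc 0 1) (hV.continuousOn_repar i) fun t ht => ?_
  rw [interior_Icc] at ht
  simpa [h] using hV.deriv_repar_pos i ht

/-- The parameter in `V` of a point of `L`. -/
noncomputable def param (x : Fin n × ℝ) : Fin m × ℝ :=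
  (hV.comp x.1, Int.fract (hV.repar x.1 x.2))

theorem param_mem (x : Fin n × ℝ) : (hV.param x).2 ∈ Ico (0 : ℝ) 1 :=
  ⟨Int.fract_nonneg _, Int.fract_lt_one _⟩

theorem param_injOn {x y : Fin n × ℝ} (hx : x.2 ∈ Icc (0 : ℝ) 1) (hy : y.2 ∈ Icc (0 : ℝ) 1)
    (h : hV.param x = hV.param y) : x = y := by
  obtain ⟨h1, h2⟩ := hV.disjoint x.1 y.1 x.2 hx y.2 hy (congrArg Prod.fst h)
    (congrArg Prod.snd h)
  exact Prod.ext h1 h2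

theorem curve_param {x : Fin n × ℝ} (hx : x.2 ∈ Icc (0 : ℝ) 1) :
    V.curve (hV.param x).1 (hV.param x).2 = L.curve x.1 x.2 := by
  rw [param, (V.periodic _).map_fract, hV.curve_eq x.1 x.2 hx]

theorem exists_param_of_mem_passages {y : Fin m × ℝ} (hy : y ∈ V.passages) :
    ∃ x : Fin n × ℝ, x.2 ∈ Icc (0 : ℝ) 1 ∧ hV.param x = y := by
  obtain ⟨⟨hy, z, hz, hne, he⟩, hv⟩ := hy
  obtain ⟨⟨i, t, ht, h⟩, -⟩ := (hV.classical_iff y z hy hz hne.symm he.symm).1 hv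
  exact ⟨(i, t), ht, h.symm⟩

theorem param_mem_passages_iff {x : Fin n × ℝ} (hx : x.2 ∈ Icc (0 : ℝ) 1) :
    hV.param x ∈ V.passages ↔ x ∈ L.passages := by
  constructor
  · rintro ⟨⟨hX, Y, hY, hne, he⟩, hv⟩
    obtain ⟨-, j, s, hs, rfl⟩ := (hV.classical_iff (hV.param x) Y hX hY hne.symm he.symm).1 hv
    refine ⟨hx, (j, s), hs, fun h => hne (congrArg hV.param h), ?_⟩
    exact (hV.curve_param (x := (j, s)) hs).symm.trans (he.trans (hV.curve_param hx))
  · rintro ⟨-, y, hy, hne, he⟩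
    have hne' : hV.param y ≠ hV.param x := fun h => hne (hV.param_injOn hy hx h)
    have he' : V.curve (hV.param y).1 (hV.param y).2 = V.curve (hV.param x).1 (hV.param x).2 := by
      rw [hV.curve_param hx, hV.curve_param hy]
      exact he
    refine ⟨⟨hV.param_mem x, hV.param y, hV.param_mem y, hne', he'⟩, ?_⟩
    exact (hV.classical_iff _ _ (hV.param_mem x) (hV.param_mem y) hne'.symm he'.symm).2
      ⟨⟨x.1, x.2, hx, rfl⟩, ⟨y.1, y.2, hy, rfl⟩⟩

theorem param_mem_passages (x : L.passages) : hV.param x.1 ∈ V.passages :=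
  (hV.param_mem_passages_iff x.2.1).2 x.2

/-- The passages of a linkoid diagram and of its virtual closure. -/
noncomputable def passageEquiv : L.passages ≃ V.passages :=
  Equiv.ofBijective (fun x => ⟨hV.param x.1, hV.param_mem_passages x⟩) <| by
    refine ⟨fun x y h => Subtype.ext (hV.param_injOn x.2.1 y.2.1 (congrArg Subtype.val h)), ?_⟩
    rintro ⟨y, hy⟩
    obtain ⟨x, hx, rfl⟩ := hV.exists_param_of_mem_passages hy
    exact ⟨⟨x, (hV.param_mem_passages_iff hx).1 hy⟩, rfl⟩

theorem coe_passageEquiv (x : L.passages) : (hV.passageEquiv x).1 = hV.param x.1 := rfl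

theorem partner_passageEquiv (x : L.passages) :
    V.partner (hV.passageEquiv x) = hV.passageEquiv (L.partner x) := by
  refine (V.partner_unique (hV.passageEquiv.injective.ne (L.partner_ne x)) ?_).symm
  rw [coe_passageEquiv, coe_passageEquiv, hV.curve_param x.2.1, hV.curve_param (L.partner x).2.1,
    L.curve_partner]

/-- By the chain rule the factor is the derivative of `repar` times the orientation sign, positive
by `repar_orientation`. Positive factors do not affect the sign of a frame. -/
theorem exists_velocity_eq {x : Fin n × ℝ} (hx : x.2 ∈ Icc (0 : ℝ) 1) :
    ∃ c : ℝ, 0 < c ∧ L.velocity o x = c • deriv (V.curve (hV.param x).1) (hV.param x).2 := by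
  refine ⟨_, hV.repar_orientation x.1 x.2 hx, ?_⟩
  rw [LinkoidDiagram.velocity, param, (V.periodic _).deriv_periodic.map_fract, mul_smul]
  congr 1
  have h1 : HasDerivAt (V.curve (hV.comp x.1)) _ (hV.repar x.1 x.2) :=
    (((V.smooth _).differentiable (by simp)) _).hasDerivAt
  have h2 : HasDerivWithinAt (hV.repar x.1) _ (Icc 0 1) x.2 :=
    ((hV.repar_smooth x.1).differentiableOn (by simp) x.2 hx).hasDerivWithinAt
  have h3 := (h1.scomp_hasDerivWithinAt x.2 h2).congr
    (fun t ht => (hV.curve_eq x.1 t ht).symm) (hV.curve_eq x.1 x.2 hx).symm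
  exact h3.derivWithin (uniqueDiffOn_Icc zero_lt_one x.2 hx)

theorem turn_passageEquiv (x : L.passages) :
    V.arcData.turn (hV.passageEquiv x) = (L.arcData o).turn x := by
  obtain ⟨a, ha, hx⟩ := hV.exists_velocity_eq x.2.1
  obtain ⟨b, hb, hy⟩ := hV.exists_velocity_eq (L.partner x).2.1
  have hc := hV.curve_param x.2.1
  simp only [VirtualLinkDiagram.arcData, LinkoidDiagram.arcData]
  rw [partner_passageEquiv, coe_passageEquiv, coe_passageEquiv, hx, hy, tripleDet_smul_smul, hc]
  simp [mul_pos ha hb]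

theorem mem_overSet_iff (x : L.passages) :
    hV.passageEquiv x ∈ V.arcData.overSet ↔ x ∈ (L.arcData o).overSet :=
  hV.over_iff x.1 x.2

end VirtualClosure

/-! ### Orientation of the arcs of a linkoid -/

namespace LinkoidDiagram

variable {n : ℕ} (L : LinkoidDiagram n) (o : LinkoidOrientation n)

/-- The nodes at which an arc starts, in the sense of the orientation. -/
def IsSource : (L.passages × Bool) ⊕ Fin (2 * n) → Prop
  | Sum.inl d => d.2 = true
  | Sum.inr e => (L.label.symm e).2 = !o (L.label.symm e).1

/-- The initial endpoint of a component. -/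
def initialNode (i : Fin n) : (L.passages × Bool) ⊕ Fin (2 * n) := Sum.inr (L.label (i, !o i))

/-- The terminal endpoint of a component. -/
def terminalNode (i : Fin n) : (L.passages × Bool) ⊕ Fin (2 * n) := Sum.inr (L.label (i, o i))

theorem isSource_initialNode (i : Fin n) : L.IsSource o (L.initialNode o i) := by
  simp [IsSource, initialNode]

theorem not_isSource_terminalNode (i : Fin n) : ¬ L.IsSource o (L.terminalNode o i) := by
  simp [IsSource, terminalNode]

theorem nodeParam_initialNode (i : Fin n) :
    L.nodeParam (L.initialNode o i) = (i, if o i then 0 else 1) := by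
  cases h : o i <;> simp [nodeParam, initialNode, h]

theorem nodeParam_terminalNode (i : Fin n) :
    L.nodeParam (L.terminalNode o i) = (i, if o i then 1 else 0) := by
  cases h : o i <;> simp [nodeParam, terminalNode, h]

variable {L o}

theorem eq_initialNode {e : Fin (2 * n)} (h : L.IsSource o (Sum.inr e)) :
    Sum.inr e = L.initialNode o (L.label.symm e).1 := by
  simp only [IsSource] at h
  rw [initialNode, ← h, Prod.mk.eta, Equiv.apply_symm_apply]

theorem eq_terminalNode {e : Fin (2 * n)} (h : ¬ L.IsSource o (Sum.inr e)) :
    Sum.inr e = L.terminalNode o (L.label.symm e).1 := by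
  simp only [IsSource, Bool.not_eq_not] at h
  rw [terminalNode, ← h, Prod.mk.eta, Equiv.apply_symm_apply]

theorem increasing_iff (a : (L.passages × Bool) ⊕ Fin (2 * n)) :
    L.increasing o a ↔ (L.IsSource o a ↔ o (L.nodeParam a).1 = true) := by
  rcases a with ⟨x, p⟩ | e
  · simp only [increasing, IsSource, nodeParam]
    cases p <;> cases o x.1.1 <;> simp
  · simp only [increasing, IsSource, nodeParam]
    cases (L.label.symm e).2 <;> cases o (L.label.symm e).1 <;> simp

theorem nodeParam_mate (a : (L.passages × Bool) ⊕ Fin (2 * n)) :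
    (L.nodeParam ((L.arcData o).mate a)).1 = (L.nodeParam a).1 := by
  rcases mate_spec (o := o) a with h | h
  · exact h.2.2.1.symm
  · exact h.2.2.1

theorem isSource_mate (a : (L.passages × Bool) ⊕ Fin (2 * n)) :
    L.IsSource o ((L.arcData o).mate a) ↔ ¬ L.IsSource o a := by
  have h1 := increasing_iff (o := o) a
  have h2 := increasing_iff (o := o) ((L.arcData o).mate a)
  rw [nodeParam_mate] at h2
  rcases mate_spec (o := o) a with h | h
  · have := h.1
    have := h.2.1
    tauto
  · have := h.1
    have := h.2.1
    tauto

end LinkoidDiagram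

/-! ### Arcs of a virtual link diagram -/

namespace VirtualLinkDiagram

variable {m : ℕ} {V : VirtualLinkDiagram m}

theorem passages_mem_Ico (x : V.passages) : x.1.2 ∈ Ico (0 : ℝ) 1 := x.2.1.1

theorem exists_isArc (x : V.passages) :
    ∃ y : V.passages, V.IsArc (Sum.inl (x, true)) (Sum.inl (y, false)) := by
  have := V.finite_passages
  have := (Set.toFinite {y : V.passages | y.1.1 = x.1.1})
  -- The function is the forward cyclic distance from `x`. It takes the value `1`, not `0`, at `x`
  -- itself, so on a circle with a single passage the arc returns to `x`.
  obtain ⟨y, hy, hmin⟩ := Set.exists_min_image {y : V.passages | y.1.1 = x.1.1}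
    (fun y => if x.1.2 < y.1.2 then y.1.2 - x.1.2 else y.1.2 - x.1.2 + 1) this ⟨x, rfl⟩
  obtain ⟨hx0, hx1⟩ := passages_mem_Ico x
  obtain ⟨hy0, hy1⟩ := passages_mem_Ico y
  refine ⟨y, rfl, rfl, hy.symm, if x.1.2 < y.1.2 then y.1.2 else y.1.2 + 1, ?_, ?_, ?_⟩
  · dsimp only
    split_ifs with h
    · exact h
    · linarith
  · dsimp only
    split_ifs with h
    · exact Int.fract_eq_self.2 ⟨hy0, hy1⟩
    · rw [Int.fract_add_one]
      exact Int.fract_eq_self.2 ⟨hy0, hy1⟩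
  · intro v hv hp
    have hm := hmin ⟨_, hp⟩ rfl
    dsimp only at hv
    change _ ≤ (if x.1.2 < Int.fract v then Int.fract v - x.1.2
      else Int.fract v - x.1.2 + 1) at hm
    obtain ⟨hv1, hv2⟩ := hv
    rcases lt_or_ge v 1 with h1 | h1
    · rw [Int.fract_eq_self.2 ⟨by linarith, h1⟩, if_pos hv1] at hm
      split_ifs at hm hv2 <;> linarith
    · have h2 : Int.fract v = v - 1 := by
        rw [← Int.fract_sub_one]
        refine Int.fract_eq_self.2 ⟨by linarith, ?_⟩
        split_ifs at hv2 <;> linarith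
      have h3 : ¬ x.1.2 < v - 1 := by
        split_ifs at hv2 <;> linarith
      rw [h2, if_neg h3] at hm
      split_ifs at hm hv2 <;> linarith

theorem isArc_unique_right {x y y' : V.passages}
    (h : V.IsArc (Sum.inl (x, true)) (Sum.inl (y, false)))
    (h' : V.IsArc (Sum.inl (x, true)) (Sum.inl (y', false))) : y = y' := by
  obtain ⟨-, -, hc, u, hu, hf, hn⟩ := h
  obtain ⟨-, -, hc', u', hu', hf', hn'⟩ := h'
  dsimp only at *
  rcases lt_trichotomy u u' with h | rfl | h
  · exact absurd (by rw [hc, hf]; exact y.2) (hn' u ⟨hu, h⟩)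
  · exact Subtype.ext (Prod.ext (hc.symm.trans hc') (hf.symm.trans hf'))
  · exact absurd (by rw [hc', hf']; exact y'.2) (hn u' ⟨hu', h⟩)

theorem isArc_unique_left {x x' y : V.passages}
    (h : V.IsArc (Sum.inl (x, true)) (Sum.inl (y, false)))
    (h' : V.IsArc (Sum.inl (x', true)) (Sum.inl (y, false))) : x = x' := by
  obtain ⟨-, -, hc, u, hu, hf, hn⟩ := h
  obtain ⟨-, -, hc', u', hu', hf', hn'⟩ := h'
  dsimp only at *
  obtain ⟨z, hz⟩ := Int.fract_eq_fract.1 (hf.trans hf'.symm)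
  have hx := Int.fract_eq_self.2 (passages_mem_Ico x)
  have hx' := Int.fract_eq_self.2 (passages_mem_Ico x')
  -- After the shift by `z` both arcs end at the same point of the line, and the later start would
  -- lie inside the longer arc.
  rcases lt_trichotomy x.1.2 (x'.1.2 + z) with h | h | h
  · refine absurd ?_ (hn (x'.1.2 + z) ⟨h, by linarith⟩)
    rw [Int.fract_add_intCast, hx', hc, ← hc']
    exact x'.2
  · refine Subtype.ext (Prod.ext (hc.trans hc'.symm) ?_)
    rw [← hx, h, Int.fract_add_intCast, hx']
  · refine absurd ?_ (hn' (x.1.2 - z) ⟨by linarith, by linarith⟩)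
    rw [Int.fract_sub_intCast, hx, hc', ← hc]
    exact x.2

/-- The successor map on the finite set of passages is injective, hence surjective. -/
theorem exists_isArc_left (y : V.passages) :
    ∃ x : V.passages, V.IsArc (Sum.inl (x, true)) (Sum.inl (y, false)) := by
  choose f hf using exists_isArc (V := V)
  have := V.finite_passages
  have hinj : Function.Injective f := fun x x' h => isArc_unique_left (hf x) (h ▸ hf x')
  obtain ⟨x, rfl⟩ := Finite.injective_iff_surjective.1 hinj y
  exact ⟨x, hf x⟩

theorem mate_eq_of_isArc {x y : V.passages}
    (h : V.IsArc (Sum.inl (x, true)) (Sum.inl (y, false))) :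
    V.arcData.mate (Sum.inl (x, true)) = Sum.inl (y, false) ∧
      V.arcData.mate (Sum.inl (y, false)) = Sum.inl (x, true) := by
  constructor
  · have hex : ∃ b, V.IsArc (Sum.inl (x, true)) b ∨ V.IsArc b (Sum.inl (x, true)) := ⟨_, Or.inl h⟩
    have : V.arcData.mate (Sum.inl (x, true)) = hex.choose := dif_pos hex
    rw [this]
    have hs := hex.choose_spec
    generalize hex.choose = b at hs
    rcases b with ⟨y', p⟩ | e
    · rcases hs with hs | hs
      · obtain rfl : p = false := hs.2.1
        rw [isArc_unique_right h hs]
      · exact absurd hs.2.1 (by simp)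
    · exact e.elim
  · have hex : ∃ b, V.IsArc (Sum.inl (y, false)) b ∨ V.IsArc b (Sum.inl (y, false)) :=
      ⟨_, Or.inr h⟩
    have : V.arcData.mate (Sum.inl (y, false)) = hex.choose := dif_pos hex
    rw [this]
    have hs := hex.choose_spec
    generalize hex.choose = b at hs
    rcases b with ⟨y', p⟩ | e
    · rcases hs with hs | hs
      · exact absurd hs.1 (by simp)
      · obtain rfl : p = true := hs.1
        rw [isArc_unique_left h hs]
    · exact e.elim

end VirtualLinkDiagram

/-! ### Arcs of the closure as chains of arcs of the linkoid -/

namespace VirtualClosure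

variable {n m : ℕ} {L : LinkoidDiagram n} {σ : Equiv.Perm (Fin (2 * n))}
  {o : LinkoidOrientation n} {V : VirtualLinkDiagram m} (hV : VirtualClosure L σ o V)

/-- The position of a node on a lift of its circle to the line. -/
noncomputable def position (a : (L.passages × Bool) ⊕ Fin (2 * n)) : ℝ :=
  hV.repar (L.nodeParam a).1 (L.nodeParam a).2

theorem position_initialNode (i : Fin n) :
    hV.position (L.initialNode o i) = hV.repar i (if o i then 0 else 1) := by
  rw [position, L.nodeParam_initialNode]

theorem position_terminalNode (i : Fin n) :
    hV.position (L.terminalNode o i) = hV.repar i (if o i then 1 else 0) := by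
  rw [position, L.nodeParam_terminalNode]

theorem position_mem_Ioo (i : Fin n) {t : ℝ} (ht : t ∈ Ioo (0 : ℝ) 1) :
    hV.repar i t ∈
      Ioo (hV.position (L.initialNode o i)) (hV.position (L.terminalNode o i)) := by
  have h0 : (0 : ℝ) ∈ Icc (0 : ℝ) 1 := by simp
  have h1 : (1 : ℝ) ∈ Icc (0 : ℝ) 1 := by simp
  have h' := Ioo_subset_Icc_self ht
  rw [position_initialNode, position_terminalNode]
  cases h : o i
  · have hm := hV.strictAntiOn_repar h
    exact ⟨hm h' h1 ht.2, hm h0 h' ht.1⟩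
  · have hm := hV.strictMonoOn_repar h
    exact ⟨hm h0 h' ht.1, hm h' h1 ht.2⟩

theorem position_initialNode_lt (i : Fin n) :
    hV.position (L.initialNode o i) < hV.position (L.terminalNode o i) := by
  have := hV.position_mem_Ioo i (t := 1 / 2) ⟨by norm_num, by norm_num⟩
  exact this.1.trans this.2

theorem exists_repar_eq (i : Fin n) {v : ℝ}
    (hv : v ∈ Icc (hV.position (L.initialNode o i)) (hV.position (L.terminalNode o i))) :
    ∃ t ∈ Icc (0 : ℝ) 1, hV.repar i t = v := by
  rw [position_initialNode, position_terminalNode] at hv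
  cases h : o i <;> simp only [h] at hv
  · exact intermediate_value_Icc' zero_le_one (hV.continuousOn_repar i) hv
  · exact intermediate_value_Icc zero_le_one (hV.continuousOn_repar i) hv

/-- Positions increase along the orientation of `V` even where `repar` is decreasing, and the
intermediate value theorem pulls any classical passage on the stretch back to one on the arc of `L`.
-/
theorem position_mate {a : (L.passages × Bool) ⊕ Fin (2 * n)} (ha : L.IsSource o a) :
    hV.position a < hV.position ((L.arcData o).mate a) ∧
      ∀ v ∈ Ioo (hV.position a) (hV.position ((L.arcData o).mate a)),
        (hV.comp (L.nodeParam a).1, Int.fract v) ∉ V.passages := by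
  have hinc := L.increasing_iff (o := o) a
  have hc := L.nodeParam_mate (o := o) a
  have hspec := L.mate_spec (o := o) a
  have ma := L.nodeParam_mem_Icc a
  have mb := L.nodeParam_mem_Icc ((L.arcData o).mate a)
  simp only [position]
  rw [hc]
  generalize (L.arcData o).mate a = b at *
  cases h : o (L.nodeParam a).1
  · have harc : L.IsArc o b a := by
      rcases hspec with h' | h'
      · have := h'.1
        simp_all
      · exact h'
    have hm := hV.strictAntiOn_repar h
    refine ⟨hm mb ma harc.2.2.2.1, fun v hv hp => ?_⟩
    obtain ⟨t, ht, rfl⟩ := intermediate_value_Ioo' harc.2.2.2.1.le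
      ((hV.continuousOn_repar _).mono (Icc_subset_Icc mb.1 ma.2)) hv
    have ht' : t ∈ Icc (0 : ℝ) 1 := ⟨mb.1.trans ht.1.le, ht.2.le.trans ma.2⟩
    have := (hV.param_mem_passages_iff (x := ((L.nodeParam a).1, t)) ht').1 hp
    rw [← hc] at this
    exact harc.2.2.2.2 t ht this
  · have harc : L.IsArc o a b := by
      rcases hspec with h' | h'
      · exact h'
      · have := h'.2.1
        simp_all
    have hm := hV.strictMonoOn_repar h
    refine ⟨hm ma mb harc.2.2.2.1, fun v hv hp => ?_⟩
    obtain ⟨t, ht, rfl⟩ := intermediate_value_Ioo harc.2.2.2.1.le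
      ((hV.continuousOn_repar _).mono (Icc_subset_Icc ma.1 mb.2)) hv
    have ht' : t ∈ Icc (0 : ℝ) 1 := ⟨ma.1.trans ht.1.le, ht.2.le.trans mb.2⟩
    have := (hV.param_mem_passages_iff (x := ((L.nodeParam a).1, t)) ht').1 hp
    exact harc.2.2.2.2 t ht this

/-- Induction along a circle, from component to component, until a given point `(k, t)` of the
linkoid is reached.  The number `q` is the position of this point on the lift of the circle that
belongs to the component `i`. -/
theorem circle_induction {k : Fin n} {t : ℝ} (ht : t ∈ Icc (0 : ℝ) 1) (P : Fin n → ℝ → Prop)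
    (step : ∀ i q j q', hV.comp i = hV.comp k →
      σ (L.label (i, o i)) = L.label (j, !o j) → hV.comp j = hV.comp i →
      hV.position (L.initialNode o j) ≤ q' → (∃ z : ℤ, q - q' = z) →
      q' - hV.position (L.initialNode o j) < q - hV.position (L.terminalNode o i) →
      Int.fract q' = Int.fract (hV.repar k t) →
      (hV.position (L.terminalNode o j) < q' → P j q') → P i q)
    (i : Fin n) (q : ℝ) (hi : hV.comp i = hV.comp k)
    (hlt : hV.position (L.terminalNode o i) < q)
    (hlt' : q - hV.position (L.terminalNode o i) < 1)
    (hq : Int.fract q = Int.fract (hV.repar k t)) : P i q := by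
  have hfr : ∀ i q, hV.position (L.terminalNode o i) < q →
      q - hV.position (L.terminalNode o i) < 1 → Int.fract q = Int.fract (hV.repar k t) →
      Int.fract (hV.repar k t - hV.position (L.terminalNode o i)) =
        q - hV.position (L.terminalNode o i) := by
    intro i q h1 h2 h3
    rw [← Int.fract_eq_self.2 ⟨(sub_pos.2 h1).le, h2⟩, Int.fract_eq_fract]
    obtain ⟨z, hz⟩ := Int.fract_eq_fract.1 h3.symm
    exact ⟨z, by rw [← hz]; ring⟩
  -- The induction decreases the distance, forward along the circle, from the end of the current
  -- component to the target.
  have wf : WellFounded fun i j : Fin n =>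
      Int.fract (hV.repar k t - hV.position (L.terminalNode o i)) <
        Int.fract (hV.repar k t - hV.position (L.terminalNode o j)) :=
    @Finite.wellFounded_of_trans_of_irrefl _ _ _ ⟨fun _ _ _ => lt_trans⟩ ⟨fun _ => lt_irrefl _⟩
  induction i using wf.induction generalizing q with
  | _ i ih =>
    obtain ⟨j, u, hσ, hc, hu, hfu, hno⟩ := hV.closure_arc i
    rw [← position_terminalNode] at hu hno
    rw [← position_initialNode] at hfu
    obtain ⟨z, hz⟩ := Int.fract_eq_fract.1 hfu
    -- The target lies on the linkoid, so it cannot be inside the closure arc.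
    have huq : u ≤ q := by
      by_contra h
      exact hno q ⟨hlt, not_le.1 h⟩ k t ht hi.symm hq
    -- The shift by `z` passes from the lift that belongs to `i` to the one that belongs to `j`.
    have hq' : Int.fract (q - z) = Int.fract (hV.repar k t) := by
      rw [Int.fract_sub_intCast, hq]
    refine step i q j (q - z) hi hσ hc (by linarith) ⟨z, by ring⟩ (by linarith) hq' fun hj => ?_
    have hj' := hV.position_initialNode_lt j
    refine ih j ?_ (q - z) (hc.trans hi) hj (by linarith) hq'
    rw [hfr i q hlt hlt' hq, hfr j (q - z) hj (by linarith) hq']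
    linarith

/-- A property of components that is inherited along closure arcs holds on whole circles. -/
theorem of_comp_eq (S : Fin n → Prop)
    (hS : ∀ i j, σ (L.label (i, o i)) = L.label (j, !o j) → S i → S j) {i k : Fin n}
    (h : hV.comp i = hV.comp k) (hi : S i) : S k := by
  have h0 : (0 : ℝ) ∈ Icc (0 : ℝ) 1 := by simp
  have hk : (if o i then (1 : ℝ) else 0) ∈ Icc (0 : ℝ) 1 := by split_ifs <;> simp
  set p := hV.position (L.terminalNode o i)
  -- At distance zero the target is the terminal endpoint of `i` itself, and disjointness forces `k
  -- = i`; `circle_induction` needs a positive distance.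
  by_cases hp : Int.fract (hV.repar k 0 - p) = 0
  · have hf : Int.fract (hV.repar k 0) = Int.fract (hV.position (L.terminalNode o i)) := by
      obtain ⟨z, hz⟩ := Int.fract_eq_zero_iff.1 hp
      exact Int.fract_eq_fract.2 ⟨z, hz.symm⟩
    rw [position_terminalNode] at hf
    obtain ⟨rfl, -⟩ := hV.disjoint k i 0 h0 _ hk h.symm hf
    exact hi
  · have hpos := lt_of_le_of_ne (Int.fract_nonneg (hV.repar k 0 - p)) (Ne.symm hp)
    refine hV.circle_induction h0 (fun i _ => S i → S k) ?_ i (p + Int.fract (hV.repar k 0 - p)) h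
      (by linarith) ?_ ?_ hi
    · intro i q j q' hik hσ hji hle _ _ hf ih hi
      have hj := hS i j hσ hi
      rcases lt_or_ge (hV.position (L.terminalNode o j)) q' with hlt | hge
      · exact ih hlt hj
      · obtain ⟨t, ht, rfl⟩ := hV.exists_repar_eq j ⟨hle, hge⟩
        obtain ⟨rfl, -⟩ := hV.disjoint j k t ht 0 h0 (hji.trans hik) hf
        exact hj
    · rw [add_sub_cancel_left]
      exact Int.fract_lt_one _
    · refine Int.fract_eq_fract.2 ⟨-⌊hV.repar k 0 - p⌋, ?_⟩
      rw [Int.fract]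
      push_cast
      ring

/-- An arc of `V` that reaches the passage `y` at position `q`, followed from a node `a`, either
ends there without leaving the component of `a`, or leaves this component. -/
theorem link_or_leave {a c : (L.passages × Bool) ⊕ Fin (2 * n)} {y : L.passages} {q : ℝ}
    (ha : L.IsSource o a)
    (hl : ArcData.Link (L.arcData o) σ c ((L.arcData o).mate a))
    (hc : hV.comp (L.nodeParam a).1 = hV.comp y.1.1) (hlt : hV.position a < q)
    (hq : Int.fract q = Int.fract (hV.repar y.1.1 y.1.2))
    (hno : ∀ v ∈ Ioo (hV.position a) q, (hV.comp y.1.1, Int.fract v) ∉ V.passages) :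
    ArcData.Link (L.arcData o) σ c (Sum.inl (y, false)) ∨
      ((L.arcData o).mate a = L.terminalNode o (L.nodeParam a).1 ∧
        hV.position (L.terminalNode o (L.nodeParam a).1) < q) := by
  obtain ⟨hpos, hnp⟩ := hV.position_mate ha
  have hmc := L.nodeParam_mate (o := o) a
  have hms := L.isSource_mate (o := o) a
  have hbI := L.nodeParam_mem_Icc ((L.arcData o).mate a)
  generalize (L.arcData o).mate a = b at *
  have hyq : (hV.comp y.1.1, Int.fract q) ∈ V.passages := by
    rw [hq]
    exact hV.param_mem_passages y
  have hbq : hV.position b ≤ q := by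
    by_contra h
    refine hnp q ⟨hlt, not_le.1 h⟩ ?_
    rwa [hc]
  have heq : hV.position b = q → L.nodeParam b = y.1 := by
    rintro rfl
    exact hV.param_injOn hbI y.2.1 (Prod.ext ((congrArg hV.comp hmc).trans hc) hq)
  have hnb : ¬ L.IsSource o b := fun h => hms.1 h ha
  rcases b with ⟨x, p⟩ | e
  · left
    obtain rfl : p = false := by simpa [LinkoidDiagram.IsSource] using hnb
    rcases hbq.lt_or_eq with h | h
    · refine absurd ?_ (hno _ ⟨hpos, h⟩)
      rw [← hc, ← hmc]
      exact hV.param_mem_passages x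
    · obtain rfl : x = y := Subtype.ext (heq h)
      exact hl
  · right
    have he := LinkoidDiagram.eq_terminalNode hnb
    have hce : (L.label.symm e).1 = (L.nodeParam a).1 := hmc
    rw [hce] at he
    have hpe := congrArg hV.position he
    refine ⟨he, lt_of_le_of_ne (hpe.symm.trans_le hbq) fun h => ?_⟩
    have h1 := L.mem_Ioo_of_mem_passages y.2
    rw [← (congrArg L.nodeParam he).symm.trans (heq (hpe.trans h)),
      L.nodeParam_terminalNode] at h1
    dsimp only at h1
    split_ifs at h1 <;> simp at h1

theorem link_of_isArc {x y : L.passages}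
    (h : V.IsArc (Sum.inl (hV.passageEquiv x, true)) (Sum.inl (hV.passageEquiv y, false))) :
    ArcData.Link (L.arcData o) σ (Sum.inl (x, true)) (Sum.inl (y, false)) := by
  obtain ⟨-, -, hc, u, hu, hfu, hno⟩ := h
  dsimp only at hc hu hfu hno
  rw [coe_passageEquiv, coe_passageEquiv] at hc
  rw [coe_passageEquiv] at hu hno
  rw [coe_passageEquiv] at hfu
  simp only [param] at hc hu hfu hno
  set p := hV.repar x.1.1 x.1.2 with hp
  -- The arc is given from the parameter of `x` in `[0,1)`; adding the floor moves it to the lift on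
  -- which `repar` lives.
  set q := u + ⌊p⌋ with hqdef
  have hfl := Int.fract_add_floor p
  have hq : Int.fract q = Int.fract (hV.repar y.1.1 y.1.2) := by
    rw [hqdef, Int.fract_add_intCast, hfu]
  have hpq : p < q := by linarith
  have hno' : ∀ v ∈ Ioo p q, (hV.comp y.1.1, Int.fract v) ∉ V.passages := by
    intro v hv
    have := hno (v - ⌊p⌋) ⟨by linarith [hv.1], by linarith [hv.2]⟩
    rwa [Int.fract_sub_intCast, hc] at this
  have hyp : (hV.comp y.1.1, Int.fract (hV.repar y.1.1 y.1.2)) ∈ V.passages :=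
    hV.param_mem_passages y
  have hs : L.IsSource o (Sum.inl (x, true)) := rfl
  rcases hV.link_or_leave (a := Sum.inl (x, true)) hs (.mate _) hc hpq hq hno' with h | ⟨hm, hlt⟩
  · exact h
  have hpt : p < hV.position (L.terminalNode o x.1.1) :=
    (hV.position_mem_Ioo x.1.1 (L.mem_Ioo_of_mem_passages x.2)).2
  -- Otherwise the arc would already have met `y` one turn earlier, at `q - 1`.
  have hlt1 : q - hV.position (L.terminalNode o x.1.1) < 1 := by
    by_contra hge
    refine hno' (q - 1) ⟨by linarith, by linarith⟩ ?_
    rwa [Int.fract_sub_one, hq]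
  refine hV.circle_induction y.2.1 (fun i q =>
    (∀ v ∈ Ioo (hV.position (L.terminalNode o i)) q,
      (hV.comp y.1.1, Int.fract v) ∉ V.passages) →
    ArcData.Link (L.arcData o) σ (Sum.inl (x, true)) (L.terminalNode o i) →
    ArcData.Link (L.arcData o) σ (Sum.inl (x, true)) (Sum.inl (y, false))) ?_ x.1.1 q hc hlt hlt1
    hq (fun v hv => hno' v ⟨hpt.trans hv.1, hv.2⟩) ?_
  · intro i q j q' hik hσ hji hle ⟨z, hz⟩ hlt hf ih hno hl
    have hl' := hl.through
    rw [hσ] at hl'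
    have hnj : (L.nodeParam (L.initialNode o j)).1 = j := by rw [L.nodeParam_initialNode]
    have hne : hV.position (L.initialNode o j) ≠ q' := by
      rintro rfl
      have h1 : L.nodeParam (L.initialNode o j) = y.1 :=
        hV.param_injOn (L.nodeParam_mem_Icc _) y.2.1
          (Prod.ext ((congrArg hV.comp hnj).trans (hji.trans hik)) hf)
      have h2 := L.mem_Ioo_of_mem_passages y.2
      rw [← h1, L.nodeParam_initialNode] at h2
      dsimp only at h2
      split_ifs at h2 <;> simp at h2
    have hno' : ∀ v ∈ Ioo (hV.position (L.initialNode o j)) q',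
        (hV.comp y.1.1, Int.fract v) ∉ V.passages := by
      intro v hv
      have := hno (v + z) ⟨by linarith [hv.1], by linarith [hv.2]⟩
      rwa [Int.fract_add_intCast] at this
    rcases hV.link_or_leave (L.isSource_initialNode o j) hl'
      (by rw [hnj, hji, hik]) (lt_of_le_of_ne hle hne) hf hno' with h | ⟨hm, hlt'⟩
    · exact h
    · rw [hnj] at hm hlt'
      refine ih hlt' (fun v hv => hno' v ⟨(hV.position_initialNode_lt j).trans hv.1, hv.2⟩) ?_
      rw [← hm]
      exact hl'
  · have : L.terminalNode o x.1.1 = (L.arcData o).mate (Sum.inl (x, true)) := hm.symm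
    rw [this]
    exact .mate _

theorem isClosure (hσ : IsClosurePerm σ) :
    ArcData.IsClosure (L.arcData o) σ V.arcData hV.passageEquiv := by
  have hσ' : ∀ e, σ (σ e) = e := fun e => congrArg (fun τ : Equiv.Perm _ => τ e) hσ.1
  refine ⟨L.arcData_isRegular, hσ', hV.partner_passageEquiv, hV.turn_passageEquiv,
    hV.mem_overSet_iff, ?_⟩
  rintro ⟨x, p⟩
  cases p
  · obtain ⟨y, hy⟩ := VirtualLinkDiagram.exists_isArc_left (hV.passageEquiv x)
    obtain ⟨y, rfl⟩ := hV.passageEquiv.surjective y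
    exact ⟨(y, true), (VirtualLinkDiagram.mate_eq_of_isArc hy).2,
      (hV.link_of_isArc hy).symm L.arcData_isRegular hσ'⟩
  · obtain ⟨y, hy⟩ := VirtualLinkDiagram.exists_isArc (hV.passageEquiv x)
    obtain ⟨y, rfl⟩ := hV.passageEquiv.surjective y
    exact ⟨(y, false), (VirtualLinkDiagram.mate_eq_of_isArc hy).1, hV.link_of_isArc hy⟩

/-! ### Circles without classical crossings -/

/-- `closure_arc` speaks of terminal endpoints only. The map to the next component is injective,
hence surjective, so every initial endpoint is reached too. -/
theorem comp_perm (e : Fin (2 * n)) (hσ : IsClosurePerm σ) :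
    hV.comp (L.label.symm (σ e)).1 = hV.comp (L.label.symm e).1 := by
  have hσ' : ∀ e, σ (σ e) = e := fun e => congrArg (fun τ : Equiv.Perm _ => τ e) hσ.1
  choose next hnext using hV.closure_arc
  have hn : ∀ i, σ (L.label (i, o i)) = L.label (next i, !o (next i)) :=
    fun i => (hnext i).choose_spec.1
  have hcomp : ∀ i, hV.comp (next i) = hV.comp i := fun i => (hnext i).choose_spec.2.1
  have hinj : Function.Injective next := by
    intro i j hij
    have h : σ (L.label (i, o i)) = σ (L.label (j, o j)) := by rw [hn, hn, hij]
    exact congrArg Prod.fst (L.label.injective (σ.injective h))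
  obtain ⟨⟨i, p⟩, rfl⟩ := L.label.surjective e
  by_cases hp : p = o i
  · subst hp
    rw [hn]
    simp [hcomp]
  · obtain rfl : p = !o i := by
      revert hp
      cases p <;> cases o i <;> simp
    obtain ⟨j, rfl⟩ := Finite.injective_iff_surjective.1 hinj i
    rw [← hn, hσ']
    simp [hn, hcomp]

-- A free circle is sent to the class of an endpoint on it. Without crossings, arcs and closure arcs
-- lead only to endpoints on the same circle, so the class has no darts and determines the circle.
-- Conversely, in a class without darts every component of `L` is one uncrossed arc, and by
-- `of_comp_eq` the class fills a whole circle.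
include hV in
theorem card_freeCircles (hσ : IsClosurePerm σ) (s : (L.arcData o).State) :
    Nat.card {c : ArcData.ClosedComponent s σ // ∀ d, c ≠ Quot.mk _ (Sum.inl d)} =
      V.freeCircles := by
  have hσ' : ∀ e, σ (σ e) = e := fun e => congrArg (fun τ : Equiv.Perm _ => τ e) hσ.1
  have hG : (L.arcData o).IsRegular := L.arcData_isRegular
  have key : ∀ (k : Fin n) (a : (L.arcData o).Node),
      (∀ t, (hV.comp k, t) ∉ V.passages) →
      (Quot.mk _ (L.terminalNode o k) : ArcData.ClosedComponent s σ) = Quot.mk _ a →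
      ∃ e, a = Sum.inr e ∧ hV.comp (L.label.symm e).1 = hV.comp k := by
    intro k a hk h
    have h' := (ArcData.eq_mk_iff_reflTransGen hG s hσ').1 h
    clear h
    induction h' with
    | refl => exact ⟨_, rfl, by simp⟩
    | tail _ h ih =>
      obtain ⟨e, rfl, he⟩ := ih
      rcases h with rfl | rfl
      · have hm := L.nodeParam_mate (o := o) (Sum.inr e)
        rcases hb : (L.arcData o).mate (Sum.inr e) with d | f
        · replace hm := (congrArg (fun a => (L.nodeParam a).1) hb).symm.trans hm
          have hd := hV.param_mem_passages d.1
          have hc : hV.comp d.1.1.1 = hV.comp k := (congrArg hV.comp hm).trans he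
          rw [param, hc] at hd
          exact absurd hd (hk _)
        · replace hm := (congrArg (fun a => (L.nodeParam a).1) hb).symm.trans hm
          exact ⟨f, rfl, (congrArg hV.comp hm).trans he⟩
      · exact ⟨σ e, rfl, (hV.comp_perm e hσ).trans he⟩
  have hsec := Function.surjInv_eq hV.comp_surjective
  set sec := Function.surjInv hV.comp_surjective
  symm
  let F : {i : Fin m // ∀ t : ℝ, (i, t) ∉ V.passages} →
      {c : ArcData.ClosedComponent s σ // ∀ d, c ≠ Quot.mk _ (Sum.inl d)} :=
    fun i => ⟨Quot.mk _ (L.terminalNode o (sec i.1)), fun d hd => by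
      obtain ⟨e, he, -⟩ := key (sec i.1) (Sum.inl d) (by rw [hsec]; exact i.2) hd
      cases he⟩
  refine Nat.card_eq_of_bijective F ⟨fun i j hij => ?_, ?_⟩
  · obtain ⟨e, he, hc⟩ := key (sec i.1) (L.terminalNode o (sec j.1)) (by rw [hsec]; exact i.2)
      (congrArg Subtype.val hij)
    obtain rfl : L.label (sec j.1, o (sec j.1)) = e := Sum.inr_injective he
    rw [Equiv.symm_apply_apply, hsec, hsec] at hc
    exact Subtype.ext hc.symm
  · rintro ⟨⟨a⟩, ha⟩
    have hmate : ∀ b : (L.arcData o).Node, (Quot.mk _ b : ArcData.ClosedComponent s σ) =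
        Quot.mk _ a → ∃ e, (L.arcData o).mate b = Sum.inr e := by
      intro b hb
      rcases hb' : (L.arcData o).mate b with d | e
      · refine absurd ?_ (ha d)
        rw [← hb', ArcData.mk_mate]
        exact hb.symm
      · exact ⟨e, rfl⟩
    have hinit : ∀ i, (Quot.mk _ (L.initialNode o i) : ArcData.ClosedComponent s σ) =
        Quot.mk _ a → (L.arcData o).mate (L.initialNode o i) = L.terminalNode o i := by
      intro i hi
      obtain ⟨e, he⟩ := hmate _ hi
      have h1 := L.isSource_mate (o := o) (L.initialNode o i)
      have h2 := L.nodeParam_mate (o := o) (L.initialNode o i)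
      rw [he] at h1 h2
      rw [L.nodeParam_initialNode] at h2
      refine he.trans ((LinkoidDiagram.eq_terminalNode
        fun h => h1.1 h (L.isSource_initialNode o i)).trans ?_)
      exact congrArg _ h2
    have hmk : ∀ i, (Quot.mk _ (L.initialNode o i) : ArcData.ClosedComponent s σ) =
        Quot.mk _ a → (Quot.mk _ (L.terminalNode o i) : ArcData.ClosedComponent s σ) =
          Quot.mk _ (L.initialNode o i) := fun i hi =>
      (congrArg (Quot.mk (ArcData.ClosedAdj s σ)) (hinit i hi)).symm.trans (ArcData.mk_mate s σ _)
    have hterm : ∀ i, (Quot.mk _ (L.terminalNode o i) : ArcData.ClosedComponent s σ) =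
        Quot.mk _ a → (L.arcData o).mate (L.terminalNode o i) = L.initialNode o i := by
      intro i hi
      obtain ⟨e, he⟩ := hmate _ hi
      have h1 := L.isSource_mate (o := o) (L.terminalNode o i)
      have h2 := L.nodeParam_mate (o := o) (L.terminalNode o i)
      rw [he] at h1 h2
      rw [L.nodeParam_terminalNode] at h2
      refine he.trans ((LinkoidDiagram.eq_initialNode
        (h1.2 (L.not_isSource_terminalNode o i))).trans ?_)
      exact congrArg _ h2
    obtain ⟨i, hi⟩ : ∃ i, (Quot.mk _ (L.terminalNode o i) : ArcData.ClosedComponent s σ) =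
        Quot.mk _ a := by
      rcases a with d | e
      · exact absurd rfl (ha d)
      · by_cases he : L.IsSource o (Sum.inr e)
        · have he' := LinkoidDiagram.eq_initialNode he
          have hc := congrArg (Quot.mk (ArcData.ClosedAdj s σ)) he'.symm
          exact ⟨(L.label.symm e).1, (hmk _ hc).trans hc⟩
        · exact ⟨(L.label.symm e).1, congrArg (Quot.mk (ArcData.ClosedAdj s σ))
            (LinkoidDiagram.eq_terminalNode he).symm⟩
    have hall : ∀ k, hV.comp i = hV.comp k →
        (Quot.mk _ (L.terminalNode o k) : ArcData.ClosedComponent s σ) = Quot.mk _ a := by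
      intro k hk
      refine hV.of_comp_eq (fun k => (Quot.mk _ (L.terminalNode o k) :
        ArcData.ClosedComponent s σ) = Quot.mk _ a) ?_ hk hi
      intro i j hij hi
      have hj : (Quot.mk _ (L.initialNode o j) : ArcData.ClosedComponent s σ) = Quot.mk _ a := by
        rw [← hi, ← ArcData.mk_through s σ (L.terminalNode o i)]
        exact congrArg (fun e => (Quot.mk _ (Sum.inr e) : ArcData.ClosedComponent s σ)) hij.symm
      exact (hmk j hj).trans hj
    -- A classical passage on the circle would lie inside some component of `L` whose endpoints are
    -- joined by a single arc free of passages.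
    have hfree : ∀ t, (hV.comp i, t) ∉ V.passages := by
      intro t ht
      obtain ⟨x, hx, hxt⟩ := hV.exists_param_of_mem_passages ht
      have hk := hall x.1 (congrArg Prod.fst hxt).symm
      have hm := hterm x.1 hk
      have hm' : (L.arcData o).mate (L.initialNode o x.1) = L.terminalNode o x.1 :=
        (congrArg _ hm).symm.trans (hG.mate_mate _)
      have hp := (hV.position_mate (L.isSource_initialNode o x.1)).2
      rw [hm', L.nodeParam_initialNode] at hp
      have hx' : x ∈ L.passages := (hV.param_mem_passages_iff hx).1 (by rwa [hxt])
      exact hp _ (hV.position_mem_Ioo x.1 (L.mem_Ioo_of_mem_passages hx'))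
        (hV.param_mem_passages ⟨x, hx'⟩)
    refine ⟨⟨hV.comp i, hfree⟩, Subtype.ext ?_⟩
    exact hall _ (hsec _).symm

end VirtualClosure

theorem theorem4p4 {n m : ℕ} (L : LinkoidDiagram n) (τ σ : Equiv.Perm (Fin (2 * n)))
    (hτ : L.strandPerm = τ) (hσ : IsClosurePerm σ)
    (o : LinkoidOrientation n) (V : VirtualLinkDiagram m) (hV : VirtualClosure L σ o V) :
    L.arrowPolynomial o σ = V.arrowPolynomial ∧
    writheFactor (L.arcData o).writhe * L.arrowPolynomial o σ =
      writheFactor V.arcData.writhe * V.arrowPolynomial := by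
  have h := hV.isClosure hσ
  have hfin : Finite (L.arcData o).Passage := L.finite_passages
  have heq : L.arrowPolynomial o σ = V.arrowPolynomial := by
    rw [LinkoidDiagram.arrowPolynomial, VirtualLinkDiagram.arrowPolynomial,
      ← finsum_comp_equiv h.stateEquiv]
    refine finsum_congr fun s => ?_
    -- The numbers of components agree before `1` is subtracted, so the truncated subtraction is
    -- harmless, also for the empty diagram.
    rw [h.alpha_eq, LinkoidDiagram.stateK, h.prod_eq s, h.card_eq s, hV.card_freeCircles hσ s]
  exact ⟨heq, by rw [heq, h.writhe_eq]⟩
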